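/- Let $F$ be a field of characteristic different from $2$ and $3$ containing a primitive third root of unity $\rho$, let $r,t,e,\alpha,\beta,\gamma,\delta\in F$, and let $$\Phi(z,a,b)=z^3-rbz^2-(eab+tb^2)z-f_3(a,b),\qquad f_3(a,b)=\alpha a^3+\beta a^2b+\gamma ab^2+\delta b^3 .$$ The Pappacena–Clifford algebra $C_\Phi$ is the associative $F$-algebra generated by $x,y$ subject to the relations $$(ax+by)^3=rb\,(ax+by)^2+(eab+tb^2)(ax+by)+f_3(a,b)\qquad\text{for all } a,b\in F .$$ Assume that $F[X]/(X^3-\alpha)$ is a field (so $\alpha\neq 0$, and in $C_\Phi$ one has $x^3=\alpha$). Put $$D_1=\gamma+\frac{er}{3}-\frac{\beta^2}{3\alpha},\qquad D_2=e\beta-3\alpha t-\alpha r^2,\qquad D=\frac{e^3}{27\alpha}+\frac{\beta^3}{27\alpha^2}-\frac{2r^3}{27}+\frac{\beta}{3\alpha}D_1-\frac{rt}{3}-\delta ,$$ $$y_k=\tfrac13\left(y+\rho^kxyx^{-1}+\rho^{2k}x^2yx^{-2}\right)\ (k=1,2),\qquad w=x^{-1}y_2y_1+\rho^2\frac{D_1}{3\alpha}x+\frac{D_2}{9\alpha}x^{-1},$$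 and let $E$ be the affine plane curve with coordinates $(R,S)$ $$E\colon\ (D-\rho^2eR)S+S^2+\alpha R^3-\frac{D_1^3}{27\alpha}-\frac{D_2^3}{729\alpha^3}-\rho^2\frac{D_1D_2}{9\alpha}R=0 .$$ Assume that $D\neq 0$ and that $E$ is an (affine) elliptic curve, i.e. that the discriminant of its Weierstrass form, obtained by the substitution $X=-\alpha R$, $Y=\alpha S$, is nonzero. For a field $K\supseteq F$ and $a,b\in K$ write $(a,b)_{3,K}=K[u,v: u^3=a,\ v^3=b,\ vu=\rho uv]$. Then: 1. $C_\Phi$ is an Azumaya algebra of constant rank $9$ over its center $Z$. 2. $Z=F[y_1^3,w]$, and there is an isomorphism of $F$-algebras from the coordinate ring $F[E]$ onto $Z$ that maps $R$ to $w$ and $S$ to $y_1^3$. 3. Let $\bar F$ be an algebraic closure of $F$. There is a bijection between the orbits of $\mathrm{Aut}(\bar F/F)$ on the $\bar F$-points of $E$ and the simple homomorphic images (simple quotient algebras) of $C_\Phi$ such that, for every $\bar F$-point $(R_0,S_0)$ of $E$, with $K=F(R_0,S_0)$, the image corresponding to the orbit of $(R_0,S_0)$ is isomorphic as an $F$-algebra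 to the algebra $(\alpha,S_0)_{3,K}$ if $S_0\neq0$, and to $(\rho^2eR_0-D,\alpha)_{3,K}$ if $S_0=0$; this algebra is central simple of degree $3$ over $K$, and the isomorphism can be chosen to map the images of $w$ and $y_1^3$ to $R_0$ and $S_0$. -/

import Mathlib

namespace CubicClifford

/-- The defining relations of the Clifford algebra of the monic polynomial
`z ^ d - ∑_{1 ≤ k ≤ d} f_k(a_1, …, a_n) z ^ (d - k)`: one relation for every `a ∈ F ^ n`,
obtained by substituting `a_1 x_1 + ⋯ + a_n x_n` for `z`. -/
inductive PappacenaRel (F : Type*) [Field F] (n d : ℕ) (f : ℕ → MvPolynomial (Fin n) F) :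
    FreeAlgebra F (Fin n) → FreeAlgebra F (Fin n) → Prop
  | rel (a : Fin n → F) : PappacenaRel F n d f
      ((∑ i, a i • FreeAlgebra.ι F i) ^ d)
      (∑ k ∈ Finset.Icc 1 d,
        MvPolynomial.eval a (f k) • (∑ i, a i • FreeAlgebra.ι F i) ^ (d - k))

/-- The Pappacena–Clifford algebra of `z ^ d - ∑_{1 ≤ k ≤ d} f_k(a_1, …, a_n) z ^ (d - k)`.
Only the values `f 1, …, f d` matter. -/
abbrev PappacenaClifford (F : Type*) [Field F] (n d : ℕ) (f : ℕ → MvPolynomial (Fin n) F) :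
    Type _ :=
  RingQuot (PappacenaRel F n d f)

/-- The coefficients of
`Φ(z, a, b) = z³ - r b z² - (e a b + t b²) z - (α a³ + β a² b + γ a b² + δ b³)`. -/
structure Coeffs (F : Type*) where
  (r t e α β γ δ : F)

namespace Coeffs

variable {F : Type*} [Field F] (Φ : Coeffs F) (ρ : F)

/-- The binary forms `f_1, f_2, f_3` of `Φ = z³ - f_1 z² - f_2 z - f_3`, in the variables
`a = X 0` and `b = X 1`. -/
noncomputable def form : ℕ → MvPolynomial (Fin 2) F
  | 1 => MvPolynomial.C Φ.r * MvPolynomial.X 1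
  | 2 => MvPolynomial.C Φ.e * MvPolynomial.X 0 * MvPolynomial.X 1
      + MvPolynomial.C Φ.t * MvPolynomial.X 1 ^ 2
  | 3 => MvPolynomial.C Φ.α * MvPolynomial.X 0 ^ 3
      + MvPolynomial.C Φ.β * MvPolynomial.X 0 ^ 2 * MvPolynomial.X 1
      + MvPolynomial.C Φ.γ * MvPolynomial.X 0 * MvPolynomial.X 1 ^ 2
      + MvPolynomial.C Φ.δ * MvPolynomial.X 1 ^ 3
  | _ => 0

/-- The algebra `C_Φ`. -/
abbrev Alg : Type _ := PappacenaClifford F 2 3 Φ.form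

/-- The generator `x` of `C_Φ`. -/
noncomputable def x : Φ.Alg :=
  RingQuot.mkAlgHom F (PappacenaRel F 2 3 Φ.form) (FreeAlgebra.ι F 0)

/-- The generator `y` of `C_Φ`. -/
noncomputable def y : Φ.Alg :=
  RingQuot.mkAlgHom F (PappacenaRel F 2 3 Φ.form) (FreeAlgebra.ι F 1)

theorem x_pow_three : Φ.x ^ 3 = algebraMap F Φ.Alg Φ.α := by
  have h := RingQuot.mkAlgHom_rel F (PappacenaRel.rel (F := F) (n := 2) (d := 3) (f := Φ.form)
    ![1, 0])
  simpa [x, form, Finset.sum_Icc_succ_top, Algebra.algebraMap_eq_smul_one] using h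

/-- `x⁻¹ = α⁻¹ x²`, as `x³ = α` in `C_Φ`. -/
noncomputable def xInv : Φ.Alg := Φ.α⁻¹ • Φ.x ^ 2

theorem x_mul_xInv (hα : Φ.α ≠ 0) : Φ.x * Φ.xInv = 1 := by
  rw [xInv, mul_smul_comm, ← pow_succ', x_pow_three, Algebra.algebraMap_eq_smul_one, smul_smul,
    inv_mul_cancel₀ hα, one_smul]

/-- The components `y_k = (y + ρ^k x y x⁻¹ + ρ^(2k) x² y x⁻²) / 3` of `y = y_0 + y_1 + y_2`,
which satisfy `y_k x = ρ^k x y_k`. -/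
noncomputable def yComp (k : ℕ) : Φ.Alg :=
  (3 : F)⁻¹ • (Φ.y + ρ ^ k • (Φ.x * Φ.y * Φ.xInv)
    + ρ ^ (2 * k) • (Φ.x ^ 2 * Φ.y * Φ.xInv ^ 2))

/-- `D_1 = γ + e r / 3 - β² / (3 α)`. -/
def D₁ : F := Φ.γ + Φ.e * Φ.r / 3 - Φ.β ^ 2 / (3 * Φ.α)

/-- `D_2 = e β - 3 α t - α r²`. -/
def D₂ : F := Φ.e * Φ.β - 3 * Φ.α * Φ.t - Φ.α * Φ.r ^ 2

/-- `D = e³/(27 α) + β³/(27 α²) - 2 r³/27 + β D_1/(3 α) - r t/3 - δ`. -/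
def D : F :=
  Φ.e ^ 3 / (27 * Φ.α) + Φ.β ^ 3 / (27 * Φ.α ^ 2) - 2 * Φ.r ^ 3 / 27
    + Φ.β / (3 * Φ.α) * Φ.D₁ - Φ.r * Φ.t / 3 - Φ.δ

/-- The central element `w = x⁻¹ y_2 y_1 + ρ² D_1/(3 α) x + D_2/(9 α) x⁻¹`. -/
noncomputable def w : Φ.Alg :=
  Φ.xInv * Φ.yComp ρ 2 * Φ.yComp ρ 1
    + (ρ ^ 2 * Φ.D₁ / (3 * Φ.α)) • Φ.x + (Φ.D₂ / (9 * Φ.α)) • Φ.xInv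

/-- The polynomial in `R = X 0` and `S = X 1` that defines the affine curve `E`:
`(D - ρ² e R) S + S² + α R³ - D_1³/(27 α) - D_2³/(729 α³) - ρ² D_1 D_2/(9 α) R`. -/
noncomputable def curve : MvPolynomial (Fin 2) F :=
  (MvPolynomial.C Φ.D - MvPolynomial.C (ρ ^ 2 * Φ.e) * MvPolynomial.X 0) * MvPolynomial.X 1
    + MvPolynomial.X 1 ^ 2 + MvPolynomial.C Φ.α * MvPolynomial.X 0 ^ 3
    - MvPolynomial.C (Φ.D₁ ^ 3 / (27 * Φ.α)) - MvPolynomial.C (Φ.D₂ ^ 3 / (729 * Φ.α ^ 3))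
    - MvPolynomial.C (ρ ^ 2 * Φ.D₁ * Φ.D₂ / (9 * Φ.α)) * MvPolynomial.X 0

/-- The Weierstrass form of `E`, in the coordinates `X = -α R`, `Y = α S`. -/
def weierstrass : WeierstrassCurve F where
  a₁ := ρ ^ 2 * Φ.e
  a₂ := 0
  a₃ := Φ.α * Φ.D
  a₄ := -(ρ ^ 2 * Φ.D₁ * Φ.D₂ / 9)
  a₆ := Φ.α * Φ.D₁ ^ 3 / 27 + Φ.D₂ ^ 3 / (729 * Φ.α)

/-- The equation of `E` and its Weierstrass form agree under `X = -α R`, `Y = α S`. -/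
theorem weierstrass_equation_iff (hα : Φ.α ≠ 0) (R S : F) :
    (Φ.weierstrass ρ).toAffine.Equation (-(Φ.α * R)) (Φ.α * S) ↔
      MvPolynomial.eval ![R, S] (Φ.curve ρ) = 0 := by
  have h : (Φ.α * S) ^ 2 + ρ ^ 2 * Φ.e * (-(Φ.α * R)) * (Φ.α * S) + Φ.α * Φ.D * (Φ.α * S)
      - ((-(Φ.α * R)) ^ 3 + 0 * (-(Φ.α * R)) ^ 2
        + -(ρ ^ 2 * Φ.D₁ * Φ.D₂ / 9) * (-(Φ.α * R))
        + (Φ.α * Φ.D₁ ^ 3 / 27 + Φ.D₂ ^ 3 / (729 * Φ.α)))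
      = Φ.α ^ 2 * MvPolynomial.eval ![R, S] (Φ.curve ρ) := by
    have e1 : Φ.α * Φ.D₁ ^ 3 / 27 = Φ.α ^ 2 * (Φ.D₁ ^ 3 / (27 * Φ.α)) := by
      rw [← div_div, mul_div_assoc, pow_two, mul_assoc, mul_div_cancel₀ _ hα]
    have e2 : Φ.D₂ ^ 3 / (729 * Φ.α) = Φ.α ^ 2 * (Φ.D₂ ^ 3 / (729 * Φ.α ^ 3)) := by
      rw [← div_div, ← div_div]
      field_simp
    have e3 : ρ ^ 2 * Φ.D₁ * Φ.D₂ / 9 * Φ.α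
        = Φ.α ^ 2 * (ρ ^ 2 * Φ.D₁ * Φ.D₂ / (9 * Φ.α)) := by
      rw [← div_div]
      field_simp
    simp only [curve, map_add, map_sub, map_mul, map_pow, MvPolynomial.eval_C,
      MvPolynomial.eval_X, Matrix.cons_val_zero, Matrix.cons_val_one]
    linear_combination -e1 - e2 - R * e3
  rw [WeierstrassCurve.Affine.equation_iff, ← sub_eq_zero]
  change (Φ.α * S) ^ 2 + ρ ^ 2 * Φ.e * (-(Φ.α * R)) * (Φ.α * S) + Φ.α * Φ.D * (Φ.α * S)
      - ((-(Φ.α * R)) ^ 3 + 0 * (-(Φ.α * R)) ^ 2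
        + -(ρ ^ 2 * Φ.D₁ * Φ.D₂ / 9) * (-(Φ.α * R))
        + (Φ.α * Φ.D₁ ^ 3 / 27 + Φ.D₂ ^ 3 / (729 * Φ.α))) = 0 ↔ _
  rw [h, mul_eq_zero, or_iff_right (pow_ne_zero 2 hα)]

/-- The coordinate ring `F[E]` of the affine curve `E`. -/
abbrev CoordRing : Type _ := MvPolynomial (Fin 2) F ⧸ Ideal.span {Φ.curve ρ}

/-- The coordinate functions `R` (for `i = 0`) and `S` (for `i = 1`) in `F[E]`. -/
noncomputable def coord (i : Fin 2) : Φ.CoordRing ρ :=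
  Ideal.Quotient.mk _ (MvPolynomial.X i)

/-- The points `(R_0, S_0)` of the affine curve `E` over an algebraic closure of `F`. -/
def Point : Type _ :=
  {P : Fin 2 → AlgebraicClosure F // MvPolynomial.aeval P (Φ.curve ρ) = 0}

/-- The coordinatewise action of the automorphisms of the algebraic closure over `F`. -/
noncomputable instance : MulAction Gal(AlgebraicClosure F/F) (Φ.Point ρ) where
  smul σ P := ⟨fun i => σ (P.1 i), by
    have h : MvPolynomial.aeval (fun i => σ (P.1 i))
        = (σ : AlgebraicClosure F →ₐ[F] AlgebraicClosure F).comp (MvPolynomial.aeval P.1) := by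
      ext i
      simp
    rw [h, AlgHom.comp_apply, P.2, map_zero]⟩
  one_smul _ := rfl
  mul_smul _ _ _ := rfl

end Coeffs

/-- The relations `u^n = a`, `v^n = b`, `v u = ρ u v`, where `u = ι 0` and `v = ι 1`. -/
inductive SymbolRel (K : Type*) [Field K] (n : ℕ) (ρ a b : K) :
    FreeAlgebra K (Fin 2) → FreeAlgebra K (Fin 2) → Prop
  | left : SymbolRel K n ρ a b (FreeAlgebra.ι K 0 ^ n) (algebraMap K _ a)
  | right : SymbolRel K n ρ a b (FreeAlgebra.ι K 1 ^ n) (algebraMap K _ b)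
  | comm : SymbolRel K n ρ a b (FreeAlgebra.ι K 1 * FreeAlgebra.ι K 0)
      (ρ • (FreeAlgebra.ι K 0 * FreeAlgebra.ι K 1))

/-- The symbol algebra `(a, b)_{n, K} = K[u, v : u^n = a, v^n = b, v u = ρ u v]`. -/
abbrev SymbolAlgebra (K : Type*) [Field K] (n : ℕ) (ρ a b : K) : Type _ :=
  RingQuot (SymbolRel K n ρ a b)

/-- `A` is a central simple `K`-algebra of degree `n`. -/
def IsCentralSimpleOfDegree (K A : Type*) [Field K] [Ring A] [Algebra K A] (n : ℕ) : Prop :=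
  Algebra.IsCentral K A ∧ IsSimpleRing A ∧ FiniteDimensional K A ∧ Module.finrank K A = n ^ 2

/-- The simple homomorphic images of a ring `A`, i.e. its simple quotients, recorded by the
kernel of the quotient map. -/
def SimpleImage (A : Type*) [Ring A] : Type _ :=
  {I : TwoSidedIdeal A // IsSimpleRing I.ringCon.Quotient}

namespace Coeffs

variable {F : Type*} [Field F] (Φ : Coeffs F) (ρ : F) (P : Φ.Point ρ)

/-- The field `F(R_0, S_0)` generated by the coordinates of a point `(R_0, S_0)` of `E`. -/
noncomputable abbrev pointField : IntermediateField F (AlgebraicClosure F) :=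
  IntermediateField.adjoin F (Set.range P.1)

/-- The coordinates `R_0` (for `i = 0`) and `S_0` (for `i = 1`) as elements of `F(R_0, S_0)`. -/
noncomputable def pointCoord (i : Fin 2) : Φ.pointField ρ P :=
  ⟨P.1 i, IntermediateField.subset_adjoin F _ (Set.mem_range_self i)⟩

/-- The simple image `C_Φ / I` is the `F(R_0, S_0)`-central simple algebra
`(a, b)_{3, F(R_0, S_0)}`, compatibly with the point: the images of the central elements `w` and
`y_1³` are `R_0` and `S_0`. -/
def ImageIsSymbol (I : SimpleImage Φ.Alg) (a b : Φ.pointField ρ P) : Prop :=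
  IsCentralSimpleOfDegree (Φ.pointField ρ P)
      (SymbolAlgebra (Φ.pointField ρ P) 3 (algebraMap F _ ρ) a b) 3 ∧
    ∃ ψ : I.1.ringCon.Quotient ≃ₐ[F]
        SymbolAlgebra (Φ.pointField ρ P) 3 (algebraMap F _ ρ) a b,
      ψ (I.1.ringCon.mk' (Φ.w ρ)) = algebraMap (Φ.pointField ρ P) _ (Φ.pointCoord ρ P 0) ∧
      ψ (I.1.ringCon.mk' (Φ.yComp ρ 1 ^ 3)) =
        algebraMap (Φ.pointField ρ P) _ (Φ.pointCoord ρ P 1)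

end Coeffs

end CubicClifford

/-!
Conjugation by `x` has order three, and it splits `y` into its eigencomponents: the part commuting
with `x` is determined by `x`, and `(x, y₁)`, `(x, y₂)` are symbol pairs over the subring generated
by `w` and `y₁³`. On this subring `y₁³ + y₂³` is linear in `w`, while `y₁³ y₂³` is up to a constant
the norm from `F[X]/(X³ - α)[w]` of a linear polynomial in `w`. As `F[X]/(X³ - α)` is a field and
`D ≠ 0`, the two cubes generate the unit ideal. So `C_Φ` is locally a symbol algebra, and averaging
`c ∈ C_Φ` over conjugation by the monomials `xⁱ yⱼᵏ` expresses the reduced trace form inside the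
center: this yields the center, the Azumaya property, the rank, and the fact that a two-sided ideal
is determined by its intersection with the center. Every point of `E` carries a symbol algebra on
which `C_Φ` acts, and an element `p(R) + q(R) S` of `F[E]` vanishing at all points is zero; hence
`F[E]` embeds in the center and the simple images of `C_Φ` are the fibres over the closed points of
`E`.
-/

namespace CubicClifford

section CyclicSum

variable {B : Type*} [Ring B] (n : ℕ)

/-- The sum `∑ uⁱ c uⁿ⁻ⁱ` of the conjugates of `c` by the powers of `u`, multiplied by `uⁿ` so that
`u` need not be invertible. -/
def cyclicSum (u c : B) : B := ∑ i : Fin n, u ^ (i : ℕ) * c * u ^ (n - i)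

/-- The conjugates of `c` by the monomials `uⁱ vʲ`, summed and multiplied by `vⁿ uⁿ`. For a symbol
pair it takes the role of a multiple of the reduced trace. -/
def conjSum (u v c : B) : B := cyclicSum n u (cyclicSum n v c)

/-- The monomials `uⁱ vʲ` with exponents below `n`. -/
def symbolMon (u v : B) (i : Fin n × Fin n) : B := u ^ (i.1 : ℕ) * v ^ (i.2 : ℕ)

/-- The monomials `vⁿ⁻ʲ uⁿ⁻ⁱ`, inverse to `uⁱ vʲ` up to the factor `vⁿ uⁿ`. -/
def symbolComon (u v : B) (i : Fin n × Fin n) : B := v ^ (n - i.2 : ℕ) * u ^ (n - i.1 : ℕ)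

variable {n}

theorem cyclicSum_add (u c d : B) : cyclicSum n u (c + d) = cyclicSum n u c + cyclicSum n u d := by
  simp only [cyclicSum, mul_add, add_mul, Finset.sum_add_distrib]

theorem cyclicSum_smul {R : Type*} [CommRing R] [Algebra R B] (u : B) (r : R) (c : B) :
    cyclicSum n u (r • c) = r • cyclicSum n u c := by
  simp only [cyclicSum, mul_smul_comm, smul_mul_assoc, Finset.smul_sum]

theorem cyclicSum_mem {u c : B} {I : TwoSidedIdeal B} (hc : c ∈ I) : cyclicSum n u c ∈ I :=
  sum_mem fun _ _ => I.mul_mem_right _ _ (I.mul_mem_left _ _ hc)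

theorem cyclicSum_eq_sum_reverse {u : B} (hu : ∀ c, Commute (u ^ n) c) (c : B) :
    cyclicSum n u c = ∑ i : Fin n, u ^ (n - i : ℕ) * c * u ^ (i : ℕ) := by
  cases n with
  | zero => simp [cyclicSum]
  | succ m =>
    rw [cyclicSum, Fin.sum_univ_succ, Fin.sum_univ_succ,
      ← Fin.revPerm.sum_comp _ _ (by simp)]
    congr 1
    · simpa using (hu c).eq.symm
    · refine Finset.sum_congr rfl fun i _ => ?_
      simp only [Fin.revPerm_apply, Fin.val_succ, Fin.val_rev]
      congr 3 <;> omega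

theorem conjSum_add (u v c d : B) : conjSum n u v (c + d) = conjSum n u v c + conjSum n u v d := by
  simp only [conjSum, cyclicSum_add]

theorem conjSum_smul {R : Type*} [CommRing R] [Algebra R B] (u v : B) (r : R) (c : B) :
    conjSum n u v (r • c) = r • conjSum n u v c := by
  simp only [conjSum, cyclicSum_smul]

theorem conjSum_zero (u v : B) : conjSum n u v 0 = 0 := by
  simp [conjSum, cyclicSum]

theorem conjSum_mem {u v c : B} {I : TwoSidedIdeal B} (hc : c ∈ I) : conjSum n u v c ∈ I :=
  cyclicSum_mem (cyclicSum_mem hc)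

theorem conjSum_eq_sum (u v c : B) :
    conjSum n u v c = ∑ i, symbolMon n u v i * c * symbolComon n u v i := by
  simp only [conjSum, cyclicSum, symbolMon, symbolComon, Fintype.sum_prod_type, Finset.mul_sum,
    Finset.sum_mul, mul_assoc]

theorem conjSum_swap_eq_sum {u v : B} (hu : ∀ c, Commute (u ^ n) c) (hv : ∀ c, Commute (v ^ n) c)
    (c : B) : conjSum n v u c = ∑ i, symbolComon n u v i * c * symbolMon n u v i := by
  simp only [conjSum, cyclicSum_eq_sum_reverse hu, cyclicSum_eq_sum_reverse hv, symbolMon,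
    symbolComon, Fintype.sum_prod_type, Finset.mul_sum, Finset.sum_mul, mul_assoc]
  exact Finset.sum_comm

@[simp]
theorem symbolMon_zero [NeZero n] (u v : B) : symbolMon n u v 0 = 1 := by
  simp [symbolMon]

@[simp]
theorem symbolComon_zero [NeZero n] (u v : B) : symbolComon n u v 0 = v ^ n * u ^ n := by
  simp [symbolComon]

end CyclicSum

section Weight

variable {k B : Type*} [CommRing k] [Ring B] [Algebra k B] {u v c d : B} {ω μ ν μ' ν' : k} {n : ℕ}

/-- `c` is an eigenvector with eigenvalue `μ` (on the left) and `ν` (on the right) for the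
conjugations by `u` and `v`. -/
structure HasWeight (u v : B) (μ ν : k) (c : B) : Prop where
  mul_u : c * u = μ • (u * c)
  v_mul : v * c = ν • (c * v)

theorem mul_pow_of_mul_eq_smul (h : c * u = μ • (u * c)) (p : ℕ) :
    c * u ^ p = μ ^ p • (u ^ p * c) := by
  have hs : SemiconjBy c u (μ • u) := by rw [SemiconjBy, h, smul_mul_assoc]
  have := hs.pow_right p
  rwa [SemiconjBy, smul_pow, smul_mul_assoc] at this

theorem pow_mul_of_mul_eq_smul (h : v * c = ν • (c * v)) (p : ℕ) :
    v ^ p * c = ν ^ p • (c * v ^ p) := by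
  have hs : SemiconjBy c (ν • v) v := by rw [SemiconjBy, h, mul_smul_comm]
  have := hs.pow_right p
  rw [SemiconjBy, smul_pow, mul_smul_comm] at this
  exact this.symm

theorem mul_mul_of_mul_eq_smul (hc : c * u = μ • (u * c)) (hd : d * u = μ' • (u * d)) :
    c * d * u = (μ * μ') • (u * (c * d)) := by
  rw [mul_assoc, hd, mul_smul_comm, ← mul_assoc, hc, smul_mul_assoc, smul_smul, mul_assoc,
    mul_comm]

theorem HasWeight.mul (hc : HasWeight u v μ ν c) (hd : HasWeight u v μ' ν' d) :
    HasWeight u v (μ * μ') (ν * ν') (c * d) where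
  mul_u := mul_mul_of_mul_eq_smul hc.mul_u hd.mul_u
  v_mul := by
    rw [← mul_assoc, hc.v_mul, smul_mul_assoc, mul_assoc, hd.v_mul, mul_smul_comm, smul_smul,
      mul_assoc]

theorem HasWeight.pow (hc : HasWeight u v μ ν c) (p : ℕ) :
    HasWeight u v (μ ^ p) (ν ^ p) (c ^ p) where
  mul_u := pow_mul_of_mul_eq_smul (by rw [hc.mul_u]) p
  v_mul := mul_pow_of_mul_eq_smul (by rw [hc.v_mul]) p

theorem cyclicSum_of_mul_left (hv : ∀ c, Commute (v ^ n) c) (hc : v * c = ν • (c * v)) :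
    cyclicSum n v c = (∑ i : Fin n, ν ^ (i : ℕ)) • (v ^ n * c) := by
  have hterm (i : Fin n) : v ^ (i : ℕ) * c * v ^ (n - i : ℕ) = ν ^ (i : ℕ) • (v ^ n * c) := by
    rw [pow_mul_of_mul_eq_smul hc, smul_mul_assoc, mul_assoc, ← pow_add,
      Nat.add_sub_cancel' i.is_lt.le, (hv c).eq]
  simp only [cyclicSum, hterm, Finset.sum_smul]

theorem cyclicSum_of_mul_right (hu : ∀ c, Commute (u ^ n) c) (hc : c * u = μ • (u * c)) :
    cyclicSum n u c = (∑ i : Fin n, μ ^ (i : ℕ)) • (u ^ n * c) := by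
  have hterm (i : Fin n) : u ^ (n - i : ℕ) * c * u ^ (i : ℕ) = μ ^ (i : ℕ) • (u ^ n * c) := by
    rw [mul_assoc, mul_pow_of_mul_eq_smul hc, mul_smul_comm, ← mul_assoc, ← pow_add,
      Nat.sub_add_cancel i.is_lt.le]
  simp only [cyclicSum_eq_sum_reverse hu, hterm, Finset.sum_smul]

theorem sum_pow_pow_eq_ite [IsDomain k] (hω : IsPrimitiveRoot ω n) (q : ℕ) :
    ∑ i : Fin n, (ω ^ q) ^ (i : ℕ) = if n ∣ q then (n : k) else 0 := by
  split_ifs with h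
  · simp [hω.pow_eq_one_iff_dvd q |>.2 h]
  · rw [Fin.sum_univ_eq_sum_range fun i => (ω ^ q) ^ i]
    have hmul : (∑ i ∈ Finset.range n, (ω ^ q) ^ i) * (ω ^ q - 1) = 0 := by
      rw [geom_sum_mul, pow_right_comm, hω.pow_eq_one, one_pow, sub_self]
    exact (mul_eq_zero.1 hmul).resolve_right (sub_ne_zero.2 (mt (hω.pow_eq_one_iff_dvd q).1 h))

end Weight

/-- `u` and `v` commute up to a primitive `n`-th root of unity `ω`, and their `n`-th powers are
central, as for the standard generators of a symbol algebra of degree `n`. -/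
structure IsSymbolPair {k B : Type*} [CommRing k] [Ring B] [Algebra k B] (n : ℕ) (ω : k)
    (u v : B) : Prop where
  isPrimitiveRoot : IsPrimitiveRoot ω n
  v_mul_u : v * u = ω • (u * v)
  commute_u_pow : ∀ c, Commute (u ^ n) c
  commute_v_pow : ∀ c, Commute (v ^ n) c

theorem dvd_val_add_sub_val_iff {n : ℕ} (i j : Fin n) : n ∣ i + (n - j) ↔ i = j := by
  rw [Fin.ext_iff]
  constructor
  · rintro ⟨m, hm⟩
    have : m = 1 := by nlinarith [i.is_lt, j.is_lt, Nat.sub_add_cancel j.is_lt.le]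
    subst this
    omega
  · intro hij
    rw [hij, Nat.add_sub_cancel' j.is_lt.le]

theorem dvd_val_iff_eq_zero {n : ℕ} [NeZero n] (i : Fin n) : n ∣ i ↔ i = 0 := by
  rw [Fin.ext_iff, Fin.val_zero]
  exact ⟨fun h => Nat.eq_zero_of_dvd_of_lt h i.is_lt, fun h => h ▸ dvd_zero n⟩

namespace IsSymbolPair

variable {k B : Type*} [CommRing k] [Ring B] [Algebra k B] {n : ℕ} {ω : k} {u v : B}
  (h : IsSymbolPair n ω u v)

include h

theorem hasWeight_pow_mul_pow (p q : ℕ) : HasWeight u v (ω ^ q) (ω ^ p) (u ^ p * v ^ q) := by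
  have hu : HasWeight u v (1 : k) ω u := ⟨(one_smul _ _).symm, h.v_mul_u⟩
  have hv : HasWeight u v ω (1 : k) v := ⟨h.v_mul_u, (one_smul _ _).symm⟩
  simpa using (hu.pow p).mul (hv.pow q)

theorem hasWeight_pow_mul_pow_swap (p q : ℕ) : HasWeight u v (ω ^ q) (ω ^ p) (v ^ q * u ^ p) := by
  have hu : HasWeight u v (1 : k) ω u := ⟨(one_smul _ _).symm, h.v_mul_u⟩
  have hv : HasWeight u v ω (1 : k) v := ⟨h.v_mul_u, (one_smul _ _).symm⟩
  simpa using (hv.pow q).mul (hu.pow p)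

theorem cyclicSum_mul_u {c : B} {μ : k} (hc : c * u = μ • (u * c)) :
    cyclicSum n v c * u = μ • (u * cyclicSum n v c) := by
  have hterm (i : Fin n) : v ^ (i : ℕ) * c * v ^ (n - i : ℕ) * u
      = μ • (u * (v ^ (i : ℕ) * c * v ^ (n - i : ℕ))) := by
    have hv (p : ℕ) : v ^ p * u = ω ^ p • (u * v ^ p) := pow_mul_of_mul_eq_smul h.v_mul_u p
    rw [mul_mul_of_mul_eq_smul (mul_mul_of_mul_eq_smul (hv i) hc) (hv (n - i)), mul_right_comm,
      ← pow_add, Nat.add_sub_cancel' i.is_lt.le, h.isPrimitiveRoot.pow_eq_one, one_mul]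
  simp only [cyclicSum, Finset.sum_mul, Finset.mul_sum, Finset.smul_sum, hterm]

theorem conjSum_of_mul_u {c : B} {μ : k} (hc : c * u = μ • (u * c)) :
    conjSum n u v c = (∑ i : Fin n, μ ^ (i : ℕ)) • (u ^ n * cyclicSum n v c) :=
  cyclicSum_of_mul_right h.commute_u_pow (h.cyclicSum_mul_u hc)

theorem conjSum_of_hasWeight {c : B} {μ ν : k} (hc : HasWeight u v μ ν c) :
    conjSum n u v c
      = ((∑ i : Fin n, ν ^ (i : ℕ)) * ∑ i : Fin n, μ ^ (i : ℕ)) • (v ^ n * u ^ n * c) := by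
  rw [h.conjSum_of_mul_u hc.mul_u, cyclicSum_of_mul_left h.commute_v_pow hc.v_mul, mul_smul_comm,
    smul_smul, mul_comm (∑ i : Fin n, μ ^ (i : ℕ)), ← mul_assoc, (h.commute_u_pow _).eq]

theorem conjSum_swap_of_hasWeight {c : B} {μ ν : k} (hc : HasWeight u v μ ν c) :
    conjSum n v u c
      = ((∑ i : Fin n, ν ^ (i : ℕ)) * ∑ i : Fin n, μ ^ (i : ℕ)) • (v ^ n * u ^ n * c) := by
  have huc : v * (u ^ n * c) = ν • (u ^ n * c * v) := by
    rw [← mul_assoc, ← (h.commute_u_pow v).eq, mul_assoc, hc.v_mul, mul_smul_comm, mul_assoc]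
  rw [conjSum, cyclicSum_of_mul_right h.commute_u_pow hc.mul_u, cyclicSum_smul,
    cyclicSum_of_mul_left h.commute_v_pow huc, smul_smul, mul_comm (∑ i : Fin n, μ ^ (i : ℕ)),
    mul_assoc]

variable [IsDomain k]

theorem sum_pow_mul_sum_pow_eq_ite (p q : ℕ) :
    (∑ i : Fin n, (ω ^ p) ^ (i : ℕ)) * ∑ i : Fin n, (ω ^ q) ^ (i : ℕ)
      = if n ∣ p ∧ n ∣ q then ((n ^ 2 : ℕ) : k) else 0 := by
  rw [sum_pow_pow_eq_ite h.isPrimitiveRoot, sum_pow_pow_eq_ite h.isPrimitiveRoot]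
  simp only [ite_and, mul_ite, ite_mul, zero_mul, mul_zero, pow_two, Nat.cast_mul]
  split_ifs <;> rfl

theorem conjSum_one : conjSum n u v 1 = n ^ 2 • (v ^ n * u ^ n) := by
  have hw : HasWeight u v (ω ^ 0) (ω ^ 0) 1 := by simpa using h.hasWeight_pow_mul_pow 0 0
  rw [h.conjSum_of_hasWeight hw, h.sum_pow_mul_sum_pow_eq_ite, if_pos (by simp), mul_one,
    Nat.cast_smul_eq_nsmul]

theorem conjSum_symbolMon_mul_symbolComon (i j : Fin n × Fin n) :
    conjSum n u v (symbolMon n u v i * symbolComon n u v j)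
      = if i = j then n ^ 2 • (v ^ n * u ^ n) ^ 2 else 0 := by
  have hw := (h.hasWeight_pow_mul_pow i.1 i.2).mul
    (h.hasWeight_pow_mul_pow_swap (n - j.1 : ℕ) (n - j.2 : ℕ))
  have hij : n ∣ i.1 + (n - j.1 : ℕ) ∧ n ∣ i.2 + (n - j.2 : ℕ) ↔ i = j := by
    rw [Prod.ext_iff, dvd_val_add_sub_val_iff, dvd_val_add_sub_val_iff]
  rw [symbolMon, symbolComon, h.conjSum_of_hasWeight hw, ← pow_add, ← pow_add,
    h.sum_pow_mul_sum_pow_eq_ite]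
  simp only [hij]
  split_ifs with e
  · have hmul : u ^ (i.1 : ℕ) * v ^ (i.2 : ℕ) * (v ^ (n - i.2 : ℕ) * u ^ (n - i.1 : ℕ))
        = v ^ n * u ^ n := by
      rw [mul_assoc, ← mul_assoc (v ^ _), ← pow_add, Nat.add_sub_cancel' i.2.is_lt.le, ← mul_assoc,
        ← (h.commute_v_pow _).eq, mul_assoc, ← pow_add, Nat.add_sub_cancel' i.1.is_lt.le]
    rw [← e, hmul, pow_two (_ * _), Nat.cast_smul_eq_nsmul]
  · rw [zero_smul]

variable [NeZero n]

theorem conjSum_swap_symbolMon (j : Fin n × Fin n) :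
    conjSum n v u (symbolMon n u v j) = if j = 0 then n ^ 2 • (v ^ n * u ^ n) else 0 := by
  have hj : n ∣ (j.1 : ℕ) ∧ n ∣ (j.2 : ℕ) ↔ j = 0 := by
    simp [Prod.ext_iff, dvd_val_iff_eq_zero]
  rw [symbolMon, h.conjSum_swap_of_hasWeight (h.hasWeight_pow_mul_pow _ _),
    h.sum_pow_mul_sum_pow_eq_ite]
  simp only [hj]
  split_ifs with hj0
  · rw [Nat.cast_smul_eq_nsmul]
    simp [hj0]
  · rw [zero_smul]

theorem conjSum_swap_symbolComon (j : Fin n × Fin n) :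
    conjSum n v u (symbolComon n u v j)
      = if j = 0 then n ^ 2 • (v ^ n * u ^ n) ^ 2 else 0 := by
  have hj : n ∣ (n - j.1 : ℕ) ∧ n ∣ (n - j.2 : ℕ) ↔ j = 0 := by
    simpa [Prod.ext_iff, eq_comm] using
      and_congr (dvd_val_add_sub_val_iff 0 j.1) (dvd_val_add_sub_val_iff 0 j.2)
  rw [symbolComon, h.conjSum_swap_of_hasWeight (h.hasWeight_pow_mul_pow_swap _ _),
    h.sum_pow_mul_sum_pow_eq_ite]
  simp only [hj]
  split_ifs with hj0
  · rw [Nat.cast_smul_eq_nsmul]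
    simp [hj0, pow_two (_ * _)]
  · rw [zero_smul]

theorem sum_conjSum_mul_symbolMon (c : B) :
    ∑ i, conjSum n u v (c * symbolComon n u v i) * symbolMon n u v i
      = n ^ 2 • ((v ^ n * u ^ n) ^ 2 * c) := by
  have hz : Commute ((v ^ n * u ^ n) ^ 2) c :=
    ((h.commute_v_pow c).mul_left (h.commute_u_pow c)).pow_left 2
  calc ∑ i, conjSum n u v (c * symbolComon n u v i) * symbolMon n u v i
      = ∑ j, symbolMon n u v j * c * conjSum n v u (symbolComon n u v j) := by
        simp only [conjSum_eq_sum u v, conjSum_swap_eq_sum h.commute_u_pow h.commute_v_pow,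
          Finset.sum_mul, Finset.mul_sum, mul_assoc]
        exact Finset.sum_comm
    _ = n ^ 2 • ((v ^ n * u ^ n) ^ 2 * c) := by
        simp only [h.conjSum_swap_symbolComon, mul_ite, mul_zero, Finset.sum_ite_eq',
          Finset.mem_univ, if_true, symbolMon_zero, one_mul, mul_smul_comm, hz.eq]

theorem sum_symbolComon_mul_conjSum (c : B) :
    ∑ i, symbolComon n u v i * conjSum n u v (symbolMon n u v i * c)
      = n ^ 2 • ((v ^ n * u ^ n) ^ 2 * c) := by
  have hz : Commute (v ^ n * u ^ n) c := (h.commute_v_pow c).mul_left (h.commute_u_pow c)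
  calc ∑ i, symbolComon n u v i * conjSum n u v (symbolMon n u v i * c)
      = ∑ j, conjSum n v u (symbolMon n u v j) * c * symbolComon n u v j := by
        simp only [conjSum_eq_sum u v, conjSum_swap_eq_sum h.commute_u_pow h.commute_v_pow,
          Finset.sum_mul, Finset.mul_sum, mul_assoc]
        exact Finset.sum_comm
    _ = n ^ 2 • ((v ^ n * u ^ n) ^ 2 * c) := by
        simp only [h.conjSum_swap_symbolMon, ite_mul, zero_mul, Finset.sum_ite_eq',
          Finset.mem_univ, if_true, symbolComon_zero, smul_mul_assoc]
        rw [hz.eq, pow_two (_ * _), mul_assoc c, (hz.mul_left hz).eq]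

theorem conjSum_symbolMon_of_mul_u {μ : k} {y : B} (hμ : IsPrimitiveRoot μ n)
    (hy : y * u = μ • (u * y)) (j : Fin n × Fin n) :
    conjSum n u v (symbolMon n u y j) = if j = 0 then n ^ 2 • (v ^ n * u ^ n) else 0 := by
  obtain ⟨p, q⟩ := j
  by_cases hq : q = 0
  · subst hq
    rw [symbolMon, Fin.val_zero, pow_zero, ← pow_zero v,
      h.conjSum_of_hasWeight (h.hasWeight_pow_mul_pow _ _), h.sum_pow_mul_sum_pow_eq_ite]
    simp only [dvd_val_iff_eq_zero, dvd_zero, and_true, Prod.mk_eq_zero]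
    split_ifs with hp
    · rw [Nat.cast_smul_eq_nsmul]
      simp [hp]
    · rw [zero_smul]
  · have hu : u ^ (p : ℕ) * u = (1 : k) • (u * u ^ (p : ℕ)) := by rw [one_smul, pow_mul_comm']
    have hw := mul_mul_of_mul_eq_smul hu (pow_mul_of_mul_eq_smul hy (q : ℕ))
    rw [one_mul] at hw
    rw [symbolMon, h.conjSum_of_mul_u hw, sum_pow_pow_eq_ite hμ,
      if_neg (mt (dvd_val_iff_eq_zero q).1 hq),
      zero_smul, if_neg (by simp [hq])]

end IsSymbolPair

section AzumayaCriterion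

open scoped TensorProduct

variable {R A ι κ : Type*} [CommRing R] [Ring A] [Algebra R A]

/-- The map `c ⊗ d ↦ (z ↦ τ (z c) d)`, which has a left inverse as soon as the form
`(c, d) ↦ τ (c d)` has dual bases. -/
noncomputable def traceFormEnd (τ : A →ₗ[R] R) : A ⊗[R] Aᵐᵒᵖ →ₗ[R] Module.End R A :=
  TensorProduct.lift <| LinearMap.mk₂ R
    (fun c d => (τ.comp (LinearMap.mulRight R c)).smulRight d.unop)
    (fun c c' d => by ext z; simp [mul_add, add_smul])
    (fun r c d => by ext z; simp [mul_smul])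
    (fun c d d' => by ext z; simp)
    (fun r c d => by ext z; simp [smul_comm _ r])

@[simp]
theorem traceFormEnd_tmul_apply (τ : A →ₗ[R] R) (c : A) (d : Aᵐᵒᵖ) (z : A) :
    traceFormEnd τ (c ⊗ₜ d) z = τ (z * c) • d.unop := by
  simp [traceFormEnd]

theorem traceFormEnd_injective [Fintype ι] {τ : A →ₗ[R] R} {a b : ι → A}
    (h : ∀ c, ∑ i, τ (a i * c) • b i = c) : Function.Injective (traceFormEnd τ) := by
  have hleft : Function.LeftInverse
      (fun f : Module.End R A => ∑ i, b i ⊗ₜ[R] MulOpposite.op (f (a i))) (traceFormEnd τ) := by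
    intro t
    induction t with
    | zero => simp
    | tmul c d =>
      simp only [traceFormEnd_tmul_apply, MulOpposite.op_smul, MulOpposite.op_unop,
        TensorProduct.tmul_smul, TensorProduct.smul_tmul', ← TensorProduct.sum_tmul, h]
    | add x y hx hy =>
      conv_rhs => rw [← hx, ← hy]
      simp [TensorProduct.tmul_add, Finset.sum_add_distrib]
  exact hleft.injective

theorem mulLeftRight_surjective [Fintype ι] [Fintype κ] {τ : A →ₗ[R] R} {a b : ι → A}
    {p q : κ → A} (h : ∀ c, ∑ i, τ (c * b i) • a i = c)
    (hτ : ∀ c, algebraMap R A (τ c) = ∑ k, p k * c * q k) :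
    Function.Surjective (AlgHom.mulLeftRight R A) := by
  intro f
  refine ⟨∑ i, ∑ k, (f (a i) * p k) ⊗ₜ MulOpposite.op (b i * q k), ?_⟩
  ext c
  conv_rhs => rw [← h c, map_sum]
  simp only [map_sum, LinearMap.sum_apply, AlgHom.mulLeftRight_apply, MulOpposite.unop_op,
    map_smul]
  refine Finset.sum_congr rfl fun i _ => ?_
  rw [Algebra.smul_def, Algebra.commutes, hτ, Finset.mul_sum]
  simp only [mul_assoc]

theorem isAzumaya_of_dualBases [FaithfulSMul R A] [Fintype ι] [Fintype κ] (τ : A →ₗ[R] R)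
    {a b : ι → A} {p q : κ → A} (h₁ : ∀ c, ∑ i, τ (c * b i) • a i = c)
    (h₂ : ∀ c, ∑ i, τ (a i * c) • b i = c)
    (hτ : ∀ c, algebraMap R A (τ c) = ∑ k, p k * c * q k) : IsAzumaya R A := by
  have hsplit : (Fintype.linearCombination R a).comp
      (LinearMap.pi fun i => τ.comp (LinearMap.mulRight R (b i))) = LinearMap.id := by
    ext c
    simpa [Fintype.linearCombination_apply] using h₁ c
  have : Module.Projective R A := Module.Projective.of_split _ _ hsplit
  have : Module.Finite R A := Module.Finite.of_surjective (Fintype.linearCombination R a)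
    fun c => ⟨_, LinearMap.congr_fun hsplit c⟩
  have hsurj := mulLeftRight_surjective h₁ hτ
  have : Module.Finite R (Module.End R A) :=
    Module.Finite.of_surjective (AlgHom.mulLeftRight R A).toLinearMap hsurj
  exact { bij := ⟨OrzechProperty.injective_of_surjective_of_injective (traceFormEnd τ)
    (AlgHom.mulLeftRight R A).toLinearMap (traceFormEnd_injective h₂) hsurj, hsurj⟩ }

end AzumayaCriterion

section RankAtStalk

variable {R M N : Type*} [CommRing R] [AddCommGroup M] [Module R M] [AddCommGroup N] [Module R N]
  {g : N →ₗ[R] M} {h : M →ₗ[R] N} {r : R}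

theorem localizedModule_map_map_of_comp_eq_smul (hgh : g.comp h = r • LinearMap.id)
    (S : Submonoid R) (z : LocalizedModule S M) :
    LocalizedModule.map S g (LocalizedModule.map S h z) = algebraMap R (Localization S) r • z := by
  induction z using LocalizedModule.induction_on with
  | h m s =>
    have := LinearMap.congr_fun hgh m
    simp only [LinearMap.comp_apply, LinearMap.smul_apply, LinearMap.id_apply] at this
    rw [LocalizedModule.map_mk, LocalizedModule.map_mk, this, algebraMap_smul,
      LocalizedModule.smul'_mk]

theorem rankAtStalk_eq_of_comp_eq_smul (hgh : g.comp h = r • LinearMap.id)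
    (hhg : h.comp g = r • LinearMap.id) {p : PrimeSpectrum R} (hr : r ∉ p.asIdeal) :
    Module.rankAtStalk M p = Module.rankAtStalk N p := by
  obtain ⟨c, hc⟩ : IsUnit (algebraMap R (Localization.AtPrime p.asIdeal) r) :=
    IsLocalization.map_units _ (⟨r, hr⟩ : p.asIdeal.primeCompl)
  have hbij : Function.Bijective (LocalizedModule.map p.asIdeal.primeCompl g) := by
    constructor
    · rw [injective_iff_map_eq_zero]
      intro z hz
      have := localizedModule_map_map_of_comp_eq_smul hhg p.asIdeal.primeCompl z
      rw [hz, map_zero, ← hc] at this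
      exact (c.isUnit.smul_eq_zero.1 this.symm)
    · intro z
      refine ⟨LocalizedModule.map p.asIdeal.primeCompl h ((c⁻¹ : _ˣ) • z), ?_⟩
      rw [localizedModule_map_map_of_comp_eq_smul hgh, ← hc, ← Units.smul_def, smul_inv_smul]
  exact (LinearEquiv.ofBijective _ hbij).finrank_eq.symm

end RankAtStalk

/-- Symbol pairs `(u i, v i)` whose conjugation sums are compatible multiples of elements `t i` of
`R` generating the unit ideal: locally on `R`, some `conjSum n (u i) (v i)` is a unit multiple of
the reduced trace. -/
structure IsSymbolCover {k B ι : Type*} [CommRing k] [Ring B] [Algebra k B] (R : Type*)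
    [CommRing R] [Algebra R B] (n : ℕ) (ω : ι → k) (u v : ι → B) (t : ι → R) : Prop where
  isSymbolPair : ∀ i, IsSymbolPair n (ω i) (u i) (v i)
  span_eq_top : Ideal.span (Set.range t) = ⊤
  conjSum_one : ∀ i, conjSum n (u i) (v i) 1 = algebraMap R B (t i)
  exists_conjSum : ∀ c, ∃ κ : R, ∀ i, conjSum n (u i) (v i) c = algebraMap R B (κ * t i)

theorem exists_sum_mul_eq_one {R ι : Type*} [CommRing R] [Fintype ι] {t : ι → R}
    (ht : Ideal.span (Set.range t) = ⊤) : ∃ a : ι → R, ∑ i, a i * t i = 1 :=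
  (Submodule.mem_span_range_iff_exists_fun R).1
    (ht.symm ▸ Submodule.mem_top : (1 : R) ∈ Ideal.span (Set.range t))

theorem eq_of_forall_smul_eq {R M ι : Type*} [CommRing R] [AddCommGroup M] [Module R M] [Finite ι]
    {t : ι → R} (ht : Ideal.span (Set.range t) = ⊤) {c d : M} (h : ∀ i, t i • c = t i • d) :
    c = d := by
  have := Fintype.ofFinite ι
  obtain ⟨a, ha⟩ := exists_sum_mul_eq_one ht
  rw [← one_smul R c, ← one_smul R d, ← ha, Finset.sum_smul, Finset.sum_smul]
  simp only [mul_smul, h]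

namespace IsSymbolCover

variable {k B ι R : Type*} [CommRing k] [Ring B] [Algebra k B] [CommRing R]
  [Algebra R B] {n : ℕ} {ω : ι → k} {u v : ι → B} {t : ι → R} (h : IsSymbolCover R n ω u v t)

include h

theorem map {S : Type*} [CommRing S] [Algebra S B] (f : R →+* S)
    (hf : ∀ r, algebraMap S B (f r) = algebraMap R B r) : IsSymbolCover S n ω u v (f ∘ t) where
  isSymbolPair := h.isSymbolPair
  span_eq_top := by
    rw [Set.range_comp, ← Ideal.map_span, h.span_eq_top, Ideal.map_top]
  conjSum_one i := by rw [h.conjSum_one, Function.comp_apply, hf]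
  exists_conjSum c := by
    obtain ⟨κ, hκ⟩ := h.exists_conjSum c
    exact ⟨f κ, fun i => by rw [hκ, Function.comp_apply, ← map_mul, hf]⟩

theorem mem_range_algebraMap [Finite ι] {z : B} (hz : ∀ c, Commute z c) :
    z ∈ Set.range (algebraMap R B) := by
  obtain ⟨κ, hκ⟩ := h.exists_conjSum z
  refine ⟨κ, (eq_of_forall_smul_eq h.span_eq_top fun i => ?_).symm⟩
  have hconj : conjSum n (u i) (v i) z = z * conjSum n (u i) (v i) 1 := by
    simp only [conjSum_eq_sum, Finset.mul_sum, ← mul_assoc, mul_one, ← (hz _).eq]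
  rw [Algebra.smul_def, Algebra.smul_def, ← (hz _).eq, ← h.conjSum_one, ← hconj, hκ, h.conjSum_one,
    ← map_mul, mul_comm]

theorem exists_sum_mul_sq_eq_one [Fintype ι] : ∃ a : ι → R, ∑ i, a i * t i ^ 2 = 1 := by
  refine exists_sum_mul_eq_one ?_
  rw [← Function.comp_def (· ^ 2) t, Set.range_comp]
  exact Ideal.span_pow_eq_top _ h.span_eq_top 2

variable [IsDomain k]

theorem nsmul_eq (i : ι) : n ^ 2 • (v i ^ n * u i ^ n) = algebraMap R B (t i) := by
  rw [← (h.isSymbolPair i).conjSum_one, h.conjSum_one]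

theorem nsmul_nsmul_eq (i : ι) (c : B) :
    n ^ 2 • n ^ 2 • ((v i ^ n * u i ^ n) ^ 2 * c) = t i ^ 2 • c := by
  rw [Algebra.smul_def (t i ^ 2), map_pow, ← h.nsmul_eq, smul_pow, smul_mul_assoc,
    pow_two (n ^ 2), mul_smul]

theorem ideal_le [Finite ι] [NeZero n] {I J : TwoSidedIdeal B}
    (hIJ : ∀ r : R, algebraMap R B r ∈ I → algebraMap R B r ∈ J) : I ≤ J := by
  have := Fintype.ofFinite ι
  intro c hc
  have hmem (i : ι) : t i ^ 2 • c ∈ J := by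
    rw [← h.nsmul_nsmul_eq, ← (h.isSymbolPair i).sum_conjSum_mul_symbolMon]
    refine nsmul_mem (sum_mem fun j _ => J.mul_mem_right _ _ ?_) _
    obtain ⟨κ, hκ⟩ := h.exists_conjSum (c * symbolComon n (u i) (v i) j)
    rw [hκ]
    exact hIJ _ (hκ i ▸ conjSum_mem (I.mul_mem_right _ _ hc))
  obtain ⟨a, ha⟩ := h.exists_sum_mul_sq_eq_one
  rw [← one_smul R c, ← ha, Finset.sum_smul]
  simp only [mul_smul]
  exact sum_mem fun i _ => Algebra.smul_def (a i) (t i ^ 2 • c) ▸ J.mul_mem_left _ _ (hmem i)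

section Trace

variable [Finite ι] [FaithfulSMul R B]

omit [IsDomain k] in
theorem existsUnique_trace (c : B) :
    ∃! κ : R, ∀ i, conjSum n (u i) (v i) c = algebraMap R B (κ * t i) := by
  refine existsUnique_of_exists_of_unique (h.exists_conjSum c) fun κ κ' hκ hκ' => ?_
  refine eq_of_forall_smul_eq h.span_eq_top fun i => FaithfulSMul.algebraMap_injective R B ?_
  rw [smul_eq_mul, smul_eq_mul, mul_comm, ← hκ, mul_comm, ← hκ']

/-- The linear form on `B` of which every `conjSum n (u i) (v i)` is a multiple: the reduced trace
divided by `n`. -/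
noncomputable def trace : B →ₗ[R] R where
  toFun c := (h.existsUnique_trace c).choose
  map_add' c d := (h.existsUnique_trace (c + d)).unique (h.existsUnique_trace _).choose_spec.1
    fun i => by
      rw [conjSum_add, (h.existsUnique_trace c).choose_spec.1 i,
        (h.existsUnique_trace d).choose_spec.1 i, ← map_add, add_mul]
  map_smul' r c := (h.existsUnique_trace (r • c)).unique (h.existsUnique_trace _).choose_spec.1
    fun i => by
      rw [conjSum_smul, (h.existsUnique_trace c).choose_spec.1 i, RingHom.id_apply, smul_eq_mul,
        mul_assoc, map_mul _ r, Algebra.smul_def]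

omit [IsDomain k] in
theorem algebraMap_trace_mul (c : B) (i : ι) :
    algebraMap R B (h.trace c * t i) = conjSum n (u i) (v i) c :=
  ((h.existsUnique_trace c).choose_spec.1 i).symm

omit [IsDomain k] in
theorem trace_mul_smul (c d : B) (i : ι) :
    (h.trace c * t i) • d = conjSum n (u i) (v i) c * d := by
  rw [Algebra.smul_def, h.algebraMap_trace_mul]

theorem sum_trace_mul_symbolComon_smul [NeZero n] (i : ι) (c : B) :
    ∑ j, (n ^ 2 * t i * h.trace (c * symbolComon n (u i) (v i) j)) • symbolMon n (u i) (v i) j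
      = t i ^ 2 • c := by
  rw [← h.nsmul_nsmul_eq, ← (h.isSymbolPair i).sum_conjSum_mul_symbolMon, Finset.smul_sum]
  refine Finset.sum_congr rfl fun j _ => ?_
  rw [mul_assoc, mul_comm (t i), mul_smul, h.trace_mul_smul, ← Nat.cast_pow,
    Nat.cast_smul_eq_nsmul]

theorem sum_trace_symbolMon_mul_smul [NeZero n] (i : ι) (c : B) :
    ∑ j, (n ^ 2 * t i * h.trace (symbolMon n (u i) (v i) j * c)) • symbolComon n (u i) (v i) j
      = t i ^ 2 • c := by
  rw [← h.nsmul_nsmul_eq, ← (h.isSymbolPair i).sum_symbolComon_mul_conjSum, Finset.smul_sum]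
  refine Finset.sum_congr rfl fun j _ => ?_
  rw [mul_assoc, mul_comm (t i), mul_smul, Algebra.smul_def (_ * _), Algebra.commutes,
    h.algebraMap_trace_mul, ← Nat.cast_pow, Nat.cast_smul_eq_nsmul]

theorem trace_symbolMon_mul_symbolComon (i : ι) (j l : Fin n × Fin n) :
    n ^ 2 * t i * h.trace (symbolMon n (u i) (v i) j * symbolComon n (u i) (v i) l)
      = if j = l then t i ^ 2 else 0 := by
  refine FaithfulSMul.algebraMap_injective R B ?_
  rw [mul_assoc, mul_comm (t i), map_mul, h.algebraMap_trace_mul,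
    (h.isSymbolPair i).conjSum_symbolMon_mul_symbolComon]
  split_ifs
  · rw [← Nat.cast_pow, map_natCast, ← nsmul_eq_mul, ← mul_one (_ ^ 2 : B), h.nsmul_nsmul_eq,
      ← Algebra.algebraMap_eq_smul_one]
  · rw [mul_zero, map_zero]

theorem isAzumaya [NeZero n] : IsAzumaya R B := by
  have := Fintype.ofFinite ι
  obtain ⟨a, ha⟩ := exists_sum_mul_eq_one h.span_eq_top
  obtain ⟨z, hz⟩ := h.exists_sum_mul_sq_eq_one
  have hsum (c : B) : c = ∑ i, z i • t i ^ 2 • c := by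
    simp only [← mul_smul, ← Finset.sum_smul, hz, one_smul]
  refine isAzumaya_of_dualBases h.trace
    (a := fun s : ι × Fin n × Fin n => (z s.1 * (n ^ 2 * t s.1)) • symbolMon n (u s.1) (v s.1) s.2)
    (b := fun s => symbolComon n (u s.1) (v s.1) s.2)
    (p := fun s : ι × Fin n × Fin n => a s.1 • symbolMon n (u s.1) (v s.1) s.2)
    (q := fun s => symbolComon n (u s.1) (v s.1) s.2) (fun c => ?_) (fun c => ?_) fun c => ?_
  · conv_rhs => rw [hsum c]
    rw [Fintype.sum_prod_type]
    simp only [← h.sum_trace_mul_symbolComon_smul, Finset.smul_sum, smul_smul, mul_assoc,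
      mul_comm (h.trace _)]
  · conv_rhs => rw [hsum c]
    simp only [Fintype.sum_prod_type, ← h.sum_trace_symbolMon_mul_smul, Finset.smul_sum, smul_smul,
      smul_mul_assoc, map_smul, smul_eq_mul, mul_assoc]
  · calc algebraMap R B (h.trace c) = ∑ i, a i • conjSum n (u i) (v i) c := by
          simp only [← h.algebraMap_trace_mul, Algebra.smul_def, ← map_mul, ← map_sum,
            mul_left_comm (a _), ← Finset.mul_sum, ha, mul_one]
      _ = _ := by
          simp only [Fintype.sum_prod_type, conjSum_eq_sum, Finset.smul_sum, smul_mul_assoc]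

theorem rankAtStalk_eq [NeZero n] (p : PrimeSpectrum R) : Module.rankAtStalk B p = n ^ 2 := by
  have : Nontrivial R := p.nontrivial
  obtain ⟨i, hi⟩ : ∃ i, t i ∉ p.asIdeal := by
    by_contra! hp
    exact p.isPrime.ne_top (top_le_iff.1
      (h.span_eq_top ▸ Ideal.span_le.2 (Set.range_subset_iff.2 hp)))
  rw [rankAtStalk_eq_of_comp_eq_smul (N := Fin n × Fin n → R) (r := t i ^ 2)
    (g := Fintype.linearCombination R (symbolMon n (u i) (v i)))
    (h := LinearMap.pi fun j =>
      (n ^ 2 * t i) • h.trace.comp (LinearMap.mulRight _ (symbolComon n (u i) (v i) j)))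
    ?_ ?_ fun hp => hi (p.isPrime.mem_of_pow_mem _ hp)]
  · rw [Module.rankAtStalk_eq_finrank_of_free]
    simp [pow_two]
  · ext c
    simpa [Fintype.linearCombination_apply] using h.sum_trace_mul_symbolComon_smul i c
  · refine (Pi.basisFun _ _).ext fun j => funext fun l => ?_
    simp [h.trace_symbolMon_mul_symbolComon, Pi.single_apply, eq_comm]

end Trace

end IsSymbolCover

theorem span_eq_top_of_adjoin_eq_top {F R A : Type*} [CommRing F] [CommRing R] [Ring A]
    [Algebra F R] [Algebra F A] [Algebra R A] [IsScalarTower F R A] {S T : Set A}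
    (hS : Algebra.adjoin F S = ⊤) (h1 : 1 ∈ Submodule.span R T)
    (hT : ∀ s ∈ S, ∀ m ∈ T, s * m ∈ Submodule.span R T) : Submodule.span R T = ⊤ := by
  have hmul : ∀ c ∈ Algebra.adjoin F S, ∀ m ∈ Submodule.span R T, c * m ∈ Submodule.span R T := by
    intro c hc
    induction hc using Algebra.adjoin_induction with
    | mem s hs =>
      have hle : Submodule.span R T ≤ (Submodule.span R T).comap (LinearMap.mulLeft R s) :=
        Submodule.span_le.2 (hT s hs)
      exact fun m hm => hle hm
    | algebraMap r =>
      intro m hm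
      rw [← Algebra.smul_def, algebra_compatible_smul R]
      exact Submodule.smul_mem _ _ hm
    | add x y _ _ hx hy => exact fun m hm => (add_mul x y m) ▸ add_mem (hx m hm) (hy m hm)
    | mul x y _ _ hx hy => exact fun m hm => (mul_assoc x y m) ▸ hx _ (hy m hm)
  refine eq_top_iff.2 fun c _ => ?_
  simpa using hmul c (hS ▸ Algebra.mem_top) 1 h1

theorem adjoin_mkAlgHom_ι {R : Type*} [CommRing R] {n : ℕ}
    (r : FreeAlgebra R (Fin n) → FreeAlgebra R (Fin n) → Prop) :
    Algebra.adjoin R (Set.range fun i => RingQuot.mkAlgHom R r (FreeAlgebra.ι R i)) = ⊤ := by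
  have h := congrArg (Subalgebra.map (RingQuot.mkAlgHom R r)) (FreeAlgebra.adjoin_range_ι R (Fin n))
  rwa [AlgHom.map_adjoin, ← Set.range_comp, Algebra.map_top,
    (AlgHom.range_eq_top _).2 (RingQuot.mkAlgHom_surjective R r)] at h

theorem exists_conjSum_of_span_eq_top {B ι R : Type*} [Ring B] [CommRing R] [Algebra R B] {n : ℕ}
    {u v : ι → B} {t : ι → R} {s : Set B} (hs : Submodule.span R s = ⊤)
    (h : ∀ c ∈ s, ∃ κ : R, ∀ i, conjSum n (u i) (v i) c = algebraMap R B (κ * t i)) (c : B) :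
    ∃ κ : R, ∀ i, conjSum n (u i) (v i) c = algebraMap R B (κ * t i) := by
  have hc : c ∈ Submodule.span R s := hs ▸ Submodule.mem_top
  induction hc using Submodule.span_induction with
  | mem x hx => exact h x hx
  | zero => exact ⟨0, fun i => by rw [conjSum_zero, zero_mul, map_zero]⟩
  | add x y _ _ hx hy =>
    obtain ⟨κ, hκ⟩ := hx
    obtain ⟨μ, hμ⟩ := hy
    exact ⟨κ + μ, fun i => by rw [conjSum_add, hκ, hμ, add_mul, map_add]⟩
  | smul r x _ hx =>
    obtain ⟨κ, hκ⟩ := hx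
    exact ⟨r * κ, fun i => by rw [conjSum_smul, hκ, mul_assoc, map_mul _ r, Algebra.smul_def]⟩

section Span

variable {R B : Type*} [CommRing R] [Ring B] [Algebra R B] {n : ℕ} [NeZero n] {u v : B} {a b : R}

theorem pow_mul_pow_mem_span_symbolMon (hu : u ^ n = algebraMap R B a)
    (hv : v ^ n = algebraMap R B b) (p q : ℕ) :
    u ^ p * v ^ q ∈ Submodule.span R (Set.range (symbolMon n u v)) := by
  have hp : u ^ p * v ^ q = (a ^ (p / n) * b ^ (q / n)) • (u ^ (p % n) * v ^ (q % n)) := by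
    conv_lhs => rw [← Nat.div_add_mod p n, ← Nat.div_add_mod q n, pow_add, pow_add, pow_mul,
      pow_mul, hu, hv, ← map_pow, ← map_pow, ← Algebra.smul_def, ← Algebra.smul_def]
    rw [smul_mul_smul_comm]
  rw [hp]
  exact Submodule.smul_mem _ _ (Submodule.subset_span
    ⟨(⟨p % n, Nat.mod_lt _ (NeZero.pos n)⟩, ⟨q % n, Nat.mod_lt _ (NeZero.pos n)⟩), rfl⟩)

end Span

section SymbolAlgebra

variable {K : Type*} [Field K] {n : ℕ} {ω a b : K}

/-- The generator `u` of `(a, b)_{n, K}`. -/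
noncomputable def symbolU (n : ℕ) (ω a b : K) : SymbolAlgebra K n ω a b :=
  RingQuot.mkAlgHom K (SymbolRel K n ω a b) (FreeAlgebra.ι K 0)

/-- The generator `v` of `(a, b)_{n, K}`. -/
noncomputable def symbolV (n : ℕ) (ω a b : K) : SymbolAlgebra K n ω a b :=
  RingQuot.mkAlgHom K (SymbolRel K n ω a b) (FreeAlgebra.ι K 1)

theorem symbolU_pow : symbolU n ω a b ^ n = algebraMap K _ a := by
  have := RingQuot.mkAlgHom_rel K (SymbolRel.left (K := K) (n := n) (ρ := ω) (a := a) (b := b))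
  rwa [map_pow, AlgHom.commutes] at this

theorem symbolV_pow : symbolV n ω a b ^ n = algebraMap K _ b := by
  have := RingQuot.mkAlgHom_rel K (SymbolRel.right (K := K) (n := n) (ρ := ω) (a := a) (b := b))
  rwa [map_pow, AlgHom.commutes] at this

theorem symbolV_mul_symbolU :
    symbolV n ω a b * symbolU n ω a b = ω • (symbolU n ω a b * symbolV n ω a b) := by
  have := RingQuot.mkAlgHom_rel K (SymbolRel.comm (K := K) (n := n) (ρ := ω) (a := a) (b := b))
  rwa [map_mul, map_smul, map_mul] at this

theorem isSymbolPair_symbol (hω : IsPrimitiveRoot ω n) :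
    IsSymbolPair n ω (symbolU n ω a b) (symbolV n ω a b) where
  isPrimitiveRoot := hω
  v_mul_u := symbolV_mul_symbolU
  commute_u_pow c := by
    rw [symbolU_pow]
    exact Algebra.commutes a c
  commute_v_pow c := by
    rw [symbolV_pow]
    exact Algebra.commutes b c

theorem adjoin_symbol : Algebra.adjoin K {symbolU n ω a b, symbolV n ω a b} = ⊤ := by
  rw [← adjoin_mkAlgHom_ι (SymbolRel K n ω a b)]
  congr 1
  ext z
  simp [Fin.exists_fin_two, symbolU, symbolV, eq_comm]

theorem funLeft_add_one_pow {L : Type*} [CommRing L] (m : ℕ) (f : ZMod n → L) (i : ZMod n) :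
    (LinearMap.funLeft L L (· + 1) ^ m) f i = f (i + m) := by
  induction m generalizing f i with
  | zero => simp
  | succ m ih => simp [pow_succ, ih, LinearMap.funLeft_apply, add_assoc]

variable [NeZero n]

theorem span_symbol :
    Submodule.span K (Set.range (symbolMon n (symbolU n ω a b) (symbolV n ω a b))) = ⊤ := by
  have hmem := pow_mul_pow_mem_span_symbolMon (symbolU_pow (n := n) (ω := ω) (a := a) (b := b))
    symbolV_pow
  refine span_eq_top_of_adjoin_eq_top adjoin_symbol (by simpa using hmem 0 0) ?_
  rintro s hs _ ⟨i, rfl⟩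
  rcases hs with rfl | rfl
  · rw [symbolMon, ← mul_assoc, ← pow_succ']
    exact hmem _ _
  · have hvu : symbolV n ω a b * symbolU n ω a b ^ (i.1 : ℕ)
        = ω ^ (i.1 : ℕ) • (symbolU n ω a b ^ (i.1 : ℕ) * symbolV n ω a b) :=
      mul_pow_of_mul_eq_smul symbolV_mul_symbolU _
    rw [symbolMon, ← mul_assoc, hvu, smul_mul_assoc, mul_assoc, ← pow_succ']
    exact Submodule.smul_mem _ _ (hmem _ _)

/-- The algebra map from `(a, b)_{n, K}` given by images of the generators. -/
noncomputable def symbolLift {A : Type*} [Ring A] [Algebra K A] {u v : A}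
    (hu : u ^ n = algebraMap K A a) (hv : v ^ n = algebraMap K A b) (hvu : v * u = ω • (u * v)) :
    SymbolAlgebra K n ω a b →ₐ[K] A :=
  RingQuot.liftAlgHom K ⟨FreeAlgebra.lift K ![u, v], by
    rintro _ _ (_ | _ | _)
    · simp [hu]
    · simp [hv]
    · simp [hvu]⟩

theorem nontrivial_symbol (hω : ω ^ n = 1) : Nontrivial (SymbolAlgebra K n ω a b) := by
  let L := AlgebraicClosure K
  obtain ⟨θ, hθ⟩ := IsAlgClosed.exists_pow_nat_eq (algebraMap K L a) (NeZero.pos n)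
  obtain ⟨η, hη⟩ := IsAlgClosed.exists_pow_nat_eq (algebraMap K L b) (NeZero.pos n)
  let χ : AddChar (ZMod n) L := AddChar.zmodChar n (ζ := algebraMap K L ω) <| by
    rw [← map_pow, hω, map_one]
  have hχ : χ 1 = algebraMap K L ω := by
    simpa using AddChar.zmodChar_apply' (ζ := algebraMap K L ω) (by rw [← map_pow, hω, map_one]) 1
  let U : Module.End L (ZMod n → L) := LinearMap.mulLeft L fun i => θ * χ i
  let V : Module.End L (ZMod n → L) := η • LinearMap.funLeft L L (· + 1)
  have hU : U ^ n = algebraMap K _ a := by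
    refine LinearMap.ext fun f => funext fun i => ?_
    simp [U, LinearMap.pow_mulLeft, Module.algebraMap_end_apply, Algebra.smul_def, mul_pow, hθ,
      ← AddChar.map_nsmul_eq_pow]
  have hV : V ^ n = algebraMap K _ b := by
    refine LinearMap.ext fun f => funext fun i => ?_
    rw [smul_pow, hη, LinearMap.smul_apply, Pi.smul_apply, funLeft_add_one_pow]
    simp [Module.algebraMap_end_apply, Algebra.smul_def]
  have hVU : V * U = ω • (U * V) := by
    refine LinearMap.ext fun f => funext fun i => ?_
    simp [U, V, LinearMap.funLeft_apply, AddChar.map_add_eq_mul, hχ, Algebra.smul_def]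
    ring
  exact (symbolLift hU hV hVU).toRingHom.domain_nontrivial

theorem isSymbolCover_symbol (hω : IsPrimitiveRoot ω n) (ha : a ≠ 0) (hb : b ≠ 0) :
    IsSymbolCover K n (fun _ : Unit => ω) (fun _ => symbolU n ω a b) (fun _ => symbolV n ω a b)
      (fun _ => n ^ 2 * (b * a)) where
  isSymbolPair _ := isSymbolPair_symbol hω
  span_eq_top := by
    have := hω.neZero'
    rw [Set.range_const, Ideal.span_singleton_eq_top]
    exact (mul_ne_zero (pow_ne_zero 2 (NeZero.ne _)) (mul_ne_zero hb ha)).isUnit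
  conjSum_one _ := by
    rw [(isSymbolPair_symbol hω).conjSum_one, symbolU_pow, symbolV_pow]
    simp
  exists_conjSum := by
    refine exists_conjSum_of_span_eq_top span_symbol ?_
    rintro _ ⟨j, rfl⟩
    refine ⟨if j = 0 then 1 else 0, fun _ => ?_⟩
    rw [(isSymbolPair_symbol hω).conjSum_symbolMon_of_mul_u hω symbolV_mul_symbolU, symbolU_pow,
      symbolV_pow]
    split_ifs <;> simp

theorem isCentralSimpleOfDegree_symbol (hω : IsPrimitiveRoot ω n) (ha : a ≠ 0) (hb : b ≠ 0) :
    IsCentralSimpleOfDegree K (SymbolAlgebra K n ω a b) n := by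
  have := nontrivial_symbol (a := a) (b := b) hω.pow_eq_one
  have hcover := isSymbolCover_symbol hω ha hb
  have hAzumaya := hcover.isAzumaya
  refine ⟨⟨fun z hz => ?_⟩, ⟨⟨fun I => or_iff_not_imp_right.2 fun hI => ?_⟩⟩, inferInstance, ?_⟩
  · exact Algebra.mem_bot.2
      (hcover.mem_range_algebraMap fun d => (Subalgebra.mem_center_iff.1 hz d).symm)
  · refine le_bot_iff.1 (hcover.ideal_le fun r hr => ?_)
    by_cases hr0 : r = 0
    · rw [hr0, map_zero]
      exact zero_mem _
    · refine absurd ?_ hI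
      rw [← TwoSidedIdeal.one_mem_iff]
      simpa [← map_mul, hr0] using I.mul_mem_left (algebraMap K _ r⁻¹) _ hr
  · have hrank := hcover.rankAtStalk_eq ⊥
    rw [Module.rankAtStalk_eq_finrank_of_free] at hrank
    exact_mod_cast hrank

end SymbolAlgebra

section NormForm

open Polynomial

variable {F : Type*} [Field F] {α : F}

theorem adjoinRoot_root_cube :
    AdjoinRoot.root (X ^ 3 - C α) ^ 3 = AdjoinRoot.of (X ^ 3 - C α) α := by
  have h := AdjoinRoot.eval₂_root (X ^ 3 - C α)
  rwa [eval₂_sub, eval₂_X_pow, eval₂_C, sub_eq_zero] at h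

theorem eq_zero_of_adjoinRoot_quadratic_eq_zero {A B C' : F}
    (h : AdjoinRoot.of (X ^ 3 - C α) A + AdjoinRoot.of _ B * AdjoinRoot.root _
      + AdjoinRoot.of _ C' * AdjoinRoot.root _ ^ 2 = 0) : A = 0 ∧ B = 0 ∧ C' = 0 := by
  have hmk : AdjoinRoot.mk (X ^ 3 - C α) (C A + C B * X + C C' * X ^ 2) = 0 := by
    simpa only [map_add, map_mul, map_pow, AdjoinRoot.mk_C, AdjoinRoot.mk_X] using h
  have hzero := eq_zero_of_dvd_of_degree_lt (AdjoinRoot.mk_eq_zero.1 hmk) <| by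
    rw [degree_X_pow_sub_C (by norm_num)]
    exact lt_of_le_of_lt (b := 2) (by compute_degree) (by norm_num)
  have hcoeff (i : ℕ) := congrArg (coeff · i) hzero
  exact ⟨by simpa using hcoeff 0, by simpa [coeff_X, coeff_C] using hcoeff 1,
    by simpa [coeff_X, coeff_C] using hcoeff 2⟩

theorem mul_conjugates_eq_norm {A : Type*} [CommRing A] {r t a b c : A}
    (hr : r ^ 2 + r + 1 = 0) :
    (a + b * t + c * t ^ 2) * (a + r * b * t + r ^ 2 * c * t ^ 2)
      * (a + r ^ 2 * b * t + r * c * t ^ 2)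
    = a ^ 3 + t ^ 3 * b ^ 3 + (t ^ 3) ^ 2 * c ^ 3 - 3 * t ^ 3 * a * b * c := by
  grind

theorem eq_zero_of_norm_eq_zero {ρ : F} (hρ : ρ ^ 2 + ρ + 1 = 0)
    (hα : IsField (AdjoinRoot (X ^ 3 - C α))) {A B C' : F}
    (h : A ^ 3 + α * B ^ 3 + α ^ 2 * C' ^ 3 - 3 * α * A * B * C' = 0) :
    A = 0 ∧ B = 0 ∧ C' = 0 := by
  have hρ0 : ρ ≠ 0 := by
    rintro rfl
    simp at hρ
  have := hα.isDomain
  have hρ' : AdjoinRoot.of (X ^ 3 - C α) ρ ^ 2 + AdjoinRoot.of _ ρ + 1 = 0 := by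
    simpa using congrArg (AdjoinRoot.of (X ^ 3 - C α)) hρ
  have hnorm := congrArg (AdjoinRoot.of (X ^ 3 - C α)) h
  simp only [map_add, map_sub, map_mul, map_pow, map_ofNat, map_zero, ← adjoinRoot_root_cube]
    at hnorm
  rw [← mul_conjugates_eq_norm hρ', mul_eq_zero, mul_eq_zero] at hnorm
  simp only [← map_pow, ← map_mul] at hnorm
  rcases hnorm with (hz | hz) | hz <;>
    simpa [hρ0] using eq_zero_of_adjoinRoot_quadratic_eq_zero hz

theorem isCoprime_of_mul_eq_aeval {A : Type*} [CommRing A] [Algebra F A] {N : F[X]}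
    (hN : ∀ c ≠ 0, N.eval c ≠ 0) {ε d : F} (hd : d ≠ 0) {R S S' : A}
    (hadd : S + S' = algebraMap F A ε * R - algebraMap F A d) (hmul : S * S' = aeval R N) :
    IsCoprime S S' := by
  by_cases hε : ε = 0
  · have hinv : algebraMap F A d⁻¹ * algebraMap F A d = 1 := by
      rw [← map_mul, inv_mul_cancel₀ hd, map_one]
    refine ⟨-algebraMap F A d⁻¹, -algebraMap F A d⁻¹, ?_⟩
    rw [hε, map_zero] at hadd
    linear_combination hinv - algebraMap F A d⁻¹ * hadd
  · set c := d / ε with hc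
    have hdc : algebraMap F A d = algebraMap F A ε * algebraMap F A c := by
      rw [← map_mul, hc, mul_div_cancel₀ _ hε]
    have hinvε : algebraMap F A ε⁻¹ * algebraMap F A ε = 1 := by
      rw [← map_mul, inv_mul_cancel₀ hε, map_one]
    have hinvN : algebraMap F A (N.eval c)⁻¹ * algebraMap F A (N.eval c) = 1 := by
      rw [← map_mul, inv_mul_cancel₀ (hN c (div_ne_zero hd hε)), map_one]
    obtain ⟨q, hq⟩ := X_sub_C_dvd_sub_C_eval (a := c) (p := N)
    have hq' : S * S' - algebraMap F A (N.eval c) = (R - algebraMap F A c) * aeval R q := by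
      rw [hmul, ← aeval_C R (N.eval c), ← aeval_C R c, ← map_sub, hq]
      simp
    refine ⟨algebraMap F A (N.eval c)⁻¹ * (S' - algebraMap F A ε⁻¹ * aeval R q),
      -(algebraMap F A (N.eval c)⁻¹ * algebraMap F A ε⁻¹ * aeval R q), ?_⟩
    linear_combination hinvN + algebraMap F A (N.eval c)⁻¹ * hq'
      - algebraMap F A (N.eval c)⁻¹ * algebraMap F A ε⁻¹ * aeval R q * (hadd - hdc)
      - algebraMap F A (N.eval c)⁻¹ * aeval R q * (R - algebraMap F A c) * hinvε

end NormForm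

section SimpleQuotient

/-- The first isomorphism theorem for algebras, in terms of two-sided ideals. -/
noncomputable def quotientKerAlgEquiv {R A B : Type*} [CommRing R] [Ring A] [Ring B] [Algebra R A]
    [Algebra R B] (f : A →ₐ[R] B) (hf : Function.Surjective f) :
    (TwoSidedIdeal.ker f).ringCon.Quotient ≃ₐ[R] B :=
  AlgEquiv.ofRingEquiv (f := RingCon.quotientKerEquivOfSurjective f.toRingHom hf)
    fun _ => f.commutes _

theorem eq_of_le_of_isSimpleRing_quotient {A : Type*} [Ring A] {I J : TwoSidedIdeal A}
    (hI : IsSimpleRing I.ringCon.Quotient) (hJ : Nontrivial J.ringCon.Quotient) (h : I ≤ J) :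
    I = J := by
  have hle : I.ringCon ≤ J.ringCon := fun a b hab => by
    rw [TwoSidedIdeal.rel_iff] at hab ⊢
    exact h hab
  have hinj := (RingCon.map _ _ hle).injective
  refine le_antisymm h fun c hc => ?_
  rw [TwoSidedIdeal.mem_iff] at hc ⊢
  exact (RingCon.eq _).1 (hinj ((RingCon.eq _).2 hc : (c : J.ringCon.Quotient) = (0 : A)))

end SimpleQuotient

section AlgebraicallyClosed

variable {F A M : Type*} [Field F] [CommRing A] [Algebra F A] [Field M] [Algebra F M]
  [IsAlgClosed M]

theorem exists_algHom_comp_eq {L : Type*} [Field L] [Algebra F L] [Algebra.IsAlgebraic F L]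
    (g : A →ₐ[F] L) (h : A →ₐ[F] M) (hgh : ∀ a, g a = 0 → h a = 0) :
    ∃ σ : L →ₐ[F] M, σ.comp g = h := by
  let h' : g.range →ₐ[F] M := AlgHom.liftOfSurjective g.rangeRestrict g.rangeRestrict_surjective h
    fun a ha => hgh a (congrArg Subtype.val ha)
  let E : IntermediateField F L := subalgebraEquivIntermediateField g.range
  obtain ⟨σ, hσ⟩ := IsAlgClosed.surjective_domRestrict_of_isAlgebraic (E := L)
    (show E →ₐ[F] M from h')
  refine ⟨σ, AlgHom.ext fun a => ?_⟩
  exact (DFunLike.congr_fun hσ (g.rangeRestrict a)).trans (AlgHom.liftOfSurjective_apply _ _ _ _ a)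

variable (M) in
theorem exists_algHom_forall_mem_eq_zero [Algebra.FiniteType F A] {J : Ideal A} (hJ : J ≠ ⊤) :
    ∃ φ : A →ₐ[F] M, ∀ a ∈ J, φ a = 0 := by
  obtain ⟨𝔪, h𝔪, hle⟩ := J.exists_le_maximal hJ
  let := Ideal.Quotient.field 𝔪
  have : Module.Finite F (A ⧸ 𝔪) := finite_of_finite_type_of_isJacobsonRing _ _
  let σ : A ⧸ 𝔪 →ₐ[F] M := IsAlgClosed.lift
  refine ⟨σ.comp (Ideal.Quotient.mkₐ F 𝔪), fun a ha => ?_⟩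
  rw [AlgHom.comp_apply, Ideal.Quotient.mkₐ_eq_mk, Ideal.Quotient.eq_zero_iff_mem.2 (hle ha),
    map_zero]

end AlgebraicallyClosed

section CubeRoot

variable {k : Type*} [CommRing k] [IsDomain k] {ρ : k} (hρ : IsPrimitiveRoot ρ 3)

include hρ

theorem sq_add_self_add_one_eq_zero : ρ ^ 2 + ρ + 1 = 0 := by
  have h := hρ.geom_sum_eq_zero (by norm_num)
  simp only [Finset.sum_range_succ, Finset.sum_range_zero] at h
  linear_combination h

theorem three_ne_zero_of_isPrimitiveRoot : (3 : k) ≠ 0 := by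
  intro h
  have hsq : (ρ - 1) ^ 2 = 0 := by
    linear_combination sq_add_self_add_one_eq_zero hρ - ρ * h
  exact hρ.ne_one (by norm_num) (sub_eq_zero.1 (pow_eq_zero_iff two_ne_zero |>.1 hsq))

end CubeRoot

theorem ne_zero_of_isField_adjoinRoot {F : Type*} [Field F] {α : F}
    (hα : IsField (AdjoinRoot (Polynomial.X ^ 3 - Polynomial.C α))) : α ≠ 0 := by
  rintro rfl
  have := hα.isDomain
  have hcube : AdjoinRoot.mk (Polynomial.X ^ 3 - Polynomial.C (0 : F)) Polynomial.X ^ 3 = 0 := by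
    rw [← map_pow, AdjoinRoot.mk_eq_zero]
    simp
  have hdvd := AdjoinRoot.mk_eq_zero.1 (pow_eq_zero_iff three_ne_zero |>.1 hcube)
  have := Polynomial.natDegree_le_of_dvd hdvd Polynomial.X_ne_zero
  simp at this

section EigenTriple

variable {k B : Type*} [CommRing k] [Ring B] [Algebra k B]

/-- Elements `x`, `y₁`, `y₂` with `x³ = α` such that `yᵢ` is an eigenvector with eigenvalue `ρⁱ` for
the conjugation by `x`. -/
structure IsEigenTriple (ρ α : k) (x y₁ y₂ : B) : Prop where
  x_cube : x * (x * x) = α • 1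
  y₁_mul_x : y₁ * x = ρ • (x * y₁)
  y₂_mul_x : y₂ * x = ρ ^ 2 • (x * y₂)

/-- The element `p₀ + p₁ x + p₂ x² + y₁ + y₂`, written as a sum of eigenvectors for the conjugation
by `x`. -/
def eigenSum (p₀ p₁ p₂ : k) (x y₁ y₂ : B) : B := p₀ • 1 + p₁ • x + p₂ • (x * x) + y₁ + y₂

theorem cube_mul {α : k} {x : B} (hx : x * (x * x) = α • 1) (z : B) :
    x * (x * (x * z)) = α • z := by
  rw [← mul_assoc x x z, ← mul_assoc x _ z, hx, smul_mul_assoc, one_mul]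

theorem mul_mul_eq_smul {ω : k} {x y : B} (hyx : y * x = ω • (x * y)) (z : B) :
    y * (x * z) = ω • (x * (y * z)) := by
  rw [← mul_assoc, hyx, smul_mul_assoc, mul_assoc]

/-- If `z y = x w - c₁ x² - c₂`, moving the factors of `y³` past those of `z³` yields the norm of
`x w - c₁ x² - c₂` over the subalgebra generated by `w`. -/
theorem cube_mul_cube_eq_norm {ρ α c₁ c₂ : k} {x y z w : B} (hρ : ρ ^ 2 + ρ + 1 = 0)
    (hx : x * (x * x) = α • 1) (hzx : z * x = ρ ^ 2 • (x * z))
    (hzy : z * y = x * w - c₁ • (x * x) - c₂ • 1) (hwx : Commute w x) (hwz : Commute w z) :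
    z ^ 3 * y ^ 3 = α • w ^ 3 - (α ^ 2 * c₁ ^ 3 + c₂ ^ 3) • 1 - (3 * α * c₁ * c₂) • w := by
  have hzy' (c : B) : z * (y * c) = x * (w * c) - c₁ • (x * (x * c)) - c₂ • c := by
    rw [← mul_assoc, hzy]
    simp only [sub_mul, smul_mul_assoc, mul_assoc, one_mul]
  simp only [pow_succ' (_ : B), pow_zero, mul_one, mul_assoc, hzy', hzy, mul_sub, mul_smul_comm,
    mul_mul_eq_smul hzx, hwz.symm.left_comm, smul_sub, smul_smul, hx, cube_mul hx, hwx.eq,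
    hwx.left_comm]
  match_scalars <;> grind (ematch := 0)

namespace IsEigenTriple

variable {ρ α p₀ p₁ p₂ a b d : k} {x y₁ y₂ : B} (h : IsEigenTriple ρ α x y₁ y₂)

include h

theorem linear_relation (hρ : ρ ^ 2 + ρ + 1 = 0) :
    x * (x * eigenSum p₀ p₁ p₂ x y₁ y₂) + x * (eigenSum p₀ p₁ p₂ x y₁ y₂ * x)
      + eigenSum p₀ p₁ p₂ x y₁ y₂ * (x * x)
      = (3 * p₀) • (x * x) + (3 * α * p₂) • x + (3 * α * p₁) • 1 := by
  simp only [eigenSum, mul_add, add_mul, smul_mul_assoc, mul_smul_comm, mul_one, one_mul,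
    mul_assoc, smul_smul, h.y₁_mul_x, h.y₂_mul_x, mul_mul_eq_smul h.y₁_mul_x,
    mul_mul_eq_smul h.y₂_mul_x, h.x_cube]
  match_scalars <;> grind (ematch := 0)

theorem mixed_relation (hρ : ρ ^ 2 + ρ + 1 = 0) {Y : B} (hY : Y = eigenSum p₀ p₁ p₂ x y₁ y₂) :
    x * (Y * Y) + Y * (x * Y) + Y * (Y * x) - ((3 * p₀) • (x * Y + Y * x) + (3 * α * p₂) • Y
      + (3 * (α * p₁ * p₂ - p₀ ^ 2 - b)) • x + (3 * α * (ρ * a - p₀ * p₂ + p₁ ^ 2)) • 1)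
    = (2 + ρ) • (x * (y₁ * y₂ - (ρ • (y₂ * y₁)
        + (((ρ - ρ ^ 2) * a) • (x * x) + ((ρ - 1) * b) • 1)))) := by
  subst hY
  simp only [eigenSum, mul_add, add_mul, mul_sub, smul_mul_assoc, mul_smul_comm, mul_one, one_mul,
    mul_assoc, smul_add, smul_sub, smul_smul, h.y₁_mul_x, h.y₂_mul_x,
    mul_mul_eq_smul h.y₁_mul_x, mul_mul_eq_smul h.y₂_mul_x, h.x_cube, cube_mul h.x_cube]
  match_scalars <;> grind

theorem cubic_relation (hρ : ρ ^ 2 + ρ + 1 = 0) {Y : B} (hY : Y = eigenSum p₀ p₁ p₂ x y₁ y₂)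
    (hy : y₁ * y₂ = ρ • (y₂ * y₁) + (((ρ - ρ ^ 2) * a) • (x * x) + ((ρ - 1) * b) • 1)) :
    Y * (Y * Y) - ((3 * p₀) • (Y * Y) + (3 * (α * p₁ * p₂ - p₀ ^ 2 - b)) • Y
      + (α ^ 2 * p₂ ^ 3 + α * p₁ ^ 3 - 2 * p₀ ^ 3 + 3 * α * ρ * a * p₁
        - p₀ * (3 * (α * p₁ * p₂ - p₀ ^ 2 - b)) - d) • 1)
    = y₁ * (y₁ * y₁) + y₂ * (y₂ * y₂) - ((3 * ρ ^ 2 * p₂) • (x * (x * (y₂ * y₁)))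
        + (3 * α * ρ ^ 2 * p₂ * a) • x + (3 * ρ ^ 2 * p₂ * b) • (x * x) - d • 1) := by
  have hy' (z : B) : y₁ * (y₂ * z) = ρ • (y₂ * (y₁ * z))
      + (((ρ - ρ ^ 2) * a) • (x * (x * z)) + ((ρ - 1) * b) • z) := by
    rw [← mul_assoc, hy]
    simp only [add_mul, smul_mul_assoc, mul_assoc, one_mul]
  subst hY
  simp only [eigenSum, mul_add, add_mul, smul_mul_assoc, mul_smul_comm, mul_one, one_mul,
    mul_assoc, smul_add, smul_smul, h.y₁_mul_x, h.y₂_mul_x, mul_mul_eq_smul h.y₁_mul_x,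
    mul_mul_eq_smul h.y₂_mul_x, h.x_cube, cube_mul h.x_cube, hy, hy']
  match_scalars <;> grind

end IsEigenTriple

end EigenTriple

section EigenComponent

variable {F B : Type*} [Field F] [Ring B] [Algebra F B]

/-- The component `(Y + q X Y X⁻¹ + q² X² Y X⁻²) / 3` of `Y` on which the conjugation by `X` acts by
`q`, if `X³ = a` and `q³ = 1`. -/
def eigenComponent (q a : F) (X Y : B) : B :=
  (3 : F)⁻¹ • (Y + (q * a⁻¹) • (X * (Y * (X * X))) + (q ^ 2 * a⁻¹) • (X * (X * (Y * X))))

variable {ρ α p₀ p₁ p₂ : F} {x y₁ y₂ : B}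

theorem mul_right_injective_of_cube (hα : α ≠ 0) (hx : x * (x * x) = α • 1) :
    Function.Injective (x * ·) := by
  intro a b hab
  have hxx := congrArg (fun z => x * (x * z)) hab
  simp only [cube_mul hx] at hxx
  exact smul_right_injective B hα hxx

theorem eigenComponent_mul {q : F} (hq : q ^ 3 = 1) (hα : α ≠ 0) (hx : x * (x * x) = α • 1)
    (Y : B) : eigenComponent q α x Y * x = q • (x * eigenComponent q α x Y) := by
  simp only [eigenComponent, mul_add, add_mul, smul_mul_assoc, mul_smul_comm, mul_one, mul_assoc,
    smul_smul, smul_add, hx, cube_mul hx]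
  match_scalars <;> grind (ematch := 0)

theorem isEigenTriple_eigenComponent (hρ : ρ ^ 2 + ρ + 1 = 0) (hα : α ≠ 0)
    (hx : x * (x * x) = α • 1) (Y : B) :
    IsEigenTriple ρ α x (eigenComponent ρ α x Y) (eigenComponent (ρ ^ 2) α x Y) where
  x_cube := hx
  y₁_mul_x := eigenComponent_mul (by linear_combination (ρ - 1) * hρ) hα hx Y
  y₂_mul_x := eigenComponent_mul (by linear_combination (ρ ^ 3 + 1) * (ρ - 1) * hρ) hα hx Y

theorem IsEigenTriple.eigenComponent_eigenSum (h : IsEigenTriple ρ α x y₁ y₂)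
    (hρ : ρ ^ 2 + ρ + 1 = 0) (h3 : (3 : F) ≠ 0) (hα : α ≠ 0) :
    eigenComponent ρ α x (eigenSum p₀ p₁ p₂ x y₁ y₂) = y₁ ∧
      eigenComponent (ρ ^ 2) α x (eigenSum p₀ p₁ p₂ x y₁ y₂) = y₂ := by
  constructor <;>
  · simp only [eigenComponent, eigenSum, mul_add, add_mul, smul_mul_assoc, mul_smul_comm, mul_one,
      one_mul, mul_assoc, smul_smul, smul_add, h.y₁_mul_x, h.y₂_mul_x,
      mul_mul_eq_smul h.y₁_mul_x, mul_mul_eq_smul h.y₂_mul_x, h.x_cube, cube_mul h.x_cube]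
    match_scalars <;> grind (ematch := 0)

theorem eigenSum_eigenComponent (hρ : ρ ^ 2 + ρ + 1 = 0) (h3 : (3 : F) ≠ 0) (hα : α ≠ 0)
    (hx : x * (x * x) = α • 1) {r e b : F} {Y : B}
    (hY : x * (x * Y) + x * (Y * x) + Y * (x * x) = r • (x * x) + e • x + b • 1) :
    eigenSum (r / 3) (b / (3 * α)) (e / (3 * α)) x (eigenComponent ρ α x Y)
      (eigenComponent (ρ ^ 2) α x Y) = Y := by
  have hxY := congrArg (x * ·) hY
  simp only [mul_add, mul_smul_comm, mul_one, hx, cube_mul hx] at hxY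
  rw [eigenSum, eigenComponent, eigenComponent]
  linear_combination (norm := skip) -(3 * α)⁻¹ • hxY
  match_scalars <;> grind (ematch := 0)

end EigenComponent

namespace Coeffs

variable {F : Type*} [Field F] (Φ : Coeffs F) (ρ : F)

/-- The coefficient `ρ² D_1 / (3 α)` of `x` in `w`. -/
def wCoeff₁ : F := ρ ^ 2 * Φ.D₁ / (3 * Φ.α)

/-- The coefficient `D_2 / (9 α)` of `x⁻¹` in `w`. -/
def wCoeff₂ : F := Φ.D₂ / (9 * Φ.α)

section Coefficients

variable {Φ ρ}

theorem t_eq (hα : Φ.α ≠ 0) (h3 : (3 : F) ≠ 0) :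
    Φ.t = 3 * (Φ.α * (Φ.β / (3 * Φ.α)) * (Φ.e / (3 * Φ.α)) - (Φ.r / 3) ^ 2 - Φ.wCoeff₂) := by
  have h9 : (9 : F) ≠ 0 := by convert pow_ne_zero 2 h3 using 1; norm_num
  unfold wCoeff₂ D₂
  field_simp
  ring

theorem three_mul_wCoeff₁ (hρ : ρ ^ 2 + ρ + 1 = 0) (hα : Φ.α ≠ 0) (h3 : (3 : F) ≠ 0) :
    3 * Φ.α * ρ * Φ.wCoeff₁ ρ = Φ.D₁ := by
  unfold wCoeff₁
  field_simp
  linear_combination Φ.D₁ * (ρ - 1) * hρ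

theorem γ_eq (hρ : ρ ^ 2 + ρ + 1 = 0) (hα : Φ.α ≠ 0) (h3 : (3 : F) ≠ 0) :
    Φ.γ = 3 * Φ.α * (ρ * Φ.wCoeff₁ ρ - Φ.r / 3 * (Φ.e / (3 * Φ.α)) + (Φ.β / (3 * Φ.α)) ^ 2) := by
  have hD : Φ.γ = Φ.D₁ - Φ.e * Φ.r / 3 + Φ.β ^ 2 / (3 * Φ.α) := by
    rw [D₁]
    ring
  rw [hD, ← three_mul_wCoeff₁ hρ hα h3]
  field_simp

theorem δ_eq (hρ : ρ ^ 2 + ρ + 1 = 0) (hα : Φ.α ≠ 0) (h3 : (3 : F) ≠ 0) :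
    Φ.δ = Φ.α ^ 2 * (Φ.e / (3 * Φ.α)) ^ 3 + Φ.α * (Φ.β / (3 * Φ.α)) ^ 3 - 2 * (Φ.r / 3) ^ 3
      + 3 * Φ.α * ρ * Φ.wCoeff₁ ρ * (Φ.β / (3 * Φ.α)) - Φ.r / 3 * Φ.t - Φ.D := by
  have h27 : (27 : F) ≠ 0 := by convert pow_ne_zero 3 h3 using 1; norm_num
  rw [three_mul_wCoeff₁ hρ hα h3, D]
  field_simp
  ring

end Coefficients

section Frame

variable {B : Type*} [Ring B] [Algebra F B]

/-- The four coefficients, at `a³`, `a² b`, `a b²` and `b³`, of the Clifford relation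
`Φ(a X + b Y, a, b) = 0`. -/
structure IsCliffordPair (X Y : B) : Prop where
  x_cube : X * (X * X) = Φ.α • 1
  linear : X * (X * Y) + X * (Y * X) + Y * (X * X) = Φ.r • (X * X) + Φ.e • X + Φ.β • 1
  quadratic : X * (Y * Y) + Y * (X * Y) + Y * (Y * X)
    = Φ.r • (X * Y + Y * X) + Φ.e • Y + Φ.t • X + Φ.γ • 1
  y_cube : Y * (Y * Y) = Φ.r • (Y * Y) + Φ.t • Y + Φ.δ • 1

/-- The relations between `x`, `y_1`, `y_2` and `w` in `C_Φ`; they present `C_Φ`. -/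
structure IsFrame (x y₁ y₂ w : B) : Prop extends IsEigenTriple ρ Φ.α x y₁ y₂ where
  y₂_mul_y₁ : y₂ * y₁ = x * w - Φ.wCoeff₁ ρ • (x * x) - Φ.wCoeff₂ • 1
  y₁_mul_y₂ : y₁ * y₂ = ρ • (x * w) - (ρ ^ 2 * Φ.wCoeff₁ ρ) • (x * x) - Φ.wCoeff₂ • 1
  cubes : y₁ * (y₁ * y₁) + y₂ * (y₂ * y₂) = (ρ ^ 2 * Φ.e) • w - Φ.D • 1

/-- The expression for `y` in terms of `x`, `y_1` and `y_2`. -/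
def ySum (x y₁ y₂ : B) : B :=
  eigenSum (Φ.r / 3) (Φ.β / (3 * Φ.α)) (Φ.e / (3 * Φ.α)) x y₁ y₂

/-- The expression for `w` in terms of `x`, `y_1` and `y_2`, with `α⁻¹ x²` for `x⁻¹`. -/
def wSum (x y₁ y₂ : B) : B :=
  Φ.α⁻¹ • (x * (x * (y₂ * y₁))) + Φ.wCoeff₁ ρ • x + (Φ.wCoeff₂ * Φ.α⁻¹) • (x * x)

variable {Φ ρ} {x y₁ y₂ w : B}

theorem x_mul_wSum (hα : Φ.α ≠ 0) (hx : x * (x * x) = Φ.α • 1) (y₁ y₂ : B) :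
    x * Φ.wSum ρ x y₁ y₂ = y₂ * y₁ + Φ.wCoeff₁ ρ • (x * x) + Φ.wCoeff₂ • 1 := by
  simp only [wSum, mul_add, mul_smul_comm, cube_mul hx, hx, smul_smul]
  rw [inv_mul_cancel₀ hα, one_smul, mul_assoc, inv_mul_cancel₀ hα, mul_one]

variable (Φ ρ) in
theorem wCoeff₁_sq : Φ.wCoeff₁ (ρ ^ 2) = ρ ^ 2 * Φ.wCoeff₁ ρ := by
  rw [wCoeff₁, wCoeff₁]
  ring

section ToFrame

variable (hρ : ρ ^ 2 + ρ + 1 = 0) (hα : Φ.α ≠ 0) (h3 : (3 : F) ≠ 0)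
  (h : IsEigenTriple ρ Φ.α x y₁ y₂)

include hρ hα h3 h

theorem linear_ySum : x * (x * Φ.ySum x y₁ y₂) + x * (Φ.ySum x y₁ y₂ * x)
    + Φ.ySum x y₁ y₂ * (x * x) = Φ.r • (x * x) + Φ.e • x + Φ.β • 1 := by
  rw [ySum, h.linear_relation hρ]
  congr 2
  · field_simp
  · field_simp
  · field_simp

theorem quadratic_ySum_iff :
    x * (Φ.ySum x y₁ y₂ * Φ.ySum x y₁ y₂) + Φ.ySum x y₁ y₂ * (x * Φ.ySum x y₁ y₂)
        + Φ.ySum x y₁ y₂ * (Φ.ySum x y₁ y₂ * x)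
      = Φ.r • (x * Φ.ySum x y₁ y₂ + Φ.ySum x y₁ y₂ * x) + Φ.e • Φ.ySum x y₁ y₂ + Φ.t • x
        + Φ.γ • 1 ↔
    y₁ * y₂ = ρ • (y₂ * y₁)
      + (((ρ - ρ ^ 2) * Φ.wCoeff₁ ρ) • (x * x) + ((ρ - 1) * Φ.wCoeff₂) • 1) := by
  have hr : 3 * (Φ.r / 3) = Φ.r := by field_simp
  have he : 3 * Φ.α * (Φ.e / (3 * Φ.α)) = Φ.e := by field_simp
  have key := h.mixed_relation hρ (Y := Φ.ySum x y₁ y₂) (a := Φ.wCoeff₁ ρ) (b := Φ.wCoeff₂) rfl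
  rw [← γ_eq hρ hα h3, ← t_eq hα h3, hr, he] at key
  have hρ2 : 2 + ρ ≠ 0 := fun h2 => h3 (by linear_combination (1 - ρ) * h2 + hρ)
  rw [← sub_eq_zero, key, smul_eq_zero, or_iff_right hρ2, mul_sub, sub_eq_zero,
    (mul_right_injective_of_cube hα h.x_cube).eq_iff]

theorem y_cube_ySum_iff (hy : y₁ * y₂ = ρ • (y₂ * y₁)
      + (((ρ - ρ ^ 2) * Φ.wCoeff₁ ρ) • (x * x) + ((ρ - 1) * Φ.wCoeff₂) • 1)) :
    Φ.ySum x y₁ y₂ * (Φ.ySum x y₁ y₂ * Φ.ySum x y₁ y₂)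
      = Φ.r • (Φ.ySum x y₁ y₂ * Φ.ySum x y₁ y₂) + Φ.t • Φ.ySum x y₁ y₂ + Φ.δ • 1 ↔
    y₁ * (y₁ * y₁) + y₂ * (y₂ * y₂) = (ρ ^ 2 * Φ.e) • Φ.wSum ρ x y₁ y₂ - Φ.D • 1 := by
  have hr : 3 * (Φ.r / 3) = Φ.r := by field_simp
  have key := h.cubic_relation hρ (Y := Φ.ySum x y₁ y₂) (d := Φ.D) rfl hy
  rw [← t_eq hα h3, ← δ_eq hρ hα h3, hr] at key
  have hw : (ρ ^ 2 * Φ.e) • Φ.wSum ρ x y₁ y₂ = (3 * ρ ^ 2 * (Φ.e / (3 * Φ.α)))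
      • (x * (x * (y₂ * y₁))) + (3 * Φ.α * ρ ^ 2 * (Φ.e / (3 * Φ.α)) * Φ.wCoeff₁ ρ) • x
      + (3 * ρ ^ 2 * (Φ.e / (3 * Φ.α)) * Φ.wCoeff₂) • (x * x) := by
    rw [wSum]
    match_scalars <;> field_simp
  rw [← sub_eq_zero, key, ← hw, sub_eq_zero]

theorem isCliffordPair_ySum_iff :
    Φ.IsCliffordPair x (Φ.ySum x y₁ y₂) ↔ Φ.IsFrame ρ x y₁ y₂ (Φ.wSum ρ x y₁ y₂) := by
  have hyy : y₂ * y₁ = x * Φ.wSum ρ x y₁ y₂ - Φ.wCoeff₁ ρ • (x * x) - Φ.wCoeff₂ • 1 := by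
    rw [x_mul_wSum hα h.x_cube]
    abel
  constructor
  · intro hY
    have hy := (quadratic_ySum_iff hρ hα h3 h).1 hY.quadratic
    exact ⟨h, hyy, by rw [hy, hyy]; module, (y_cube_ySum_iff hρ hα h3 h hy).1 hY.y_cube⟩
  · intro hw
    have hy : y₁ * y₂ = ρ • (y₂ * y₁)
        + (((ρ - ρ ^ 2) * Φ.wCoeff₁ ρ) • (x * x) + ((ρ - 1) * Φ.wCoeff₂) • 1) := by
      rw [hw.y₁_mul_y₂, hyy]
      module
    exact ⟨h.x_cube, linear_ySum hρ hα h3 h, (quadratic_ySum_iff hρ hα h3 h).2 hy,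
      (y_cube_ySum_iff hρ hα h3 h hy).2 hw.cubes⟩

end ToFrame

namespace IsFrame

variable (h : Φ.IsFrame ρ x y₁ y₂ w)

include h

theorem eq_wSum (hα : Φ.α ≠ 0) : w = Φ.wSum ρ x y₁ y₂ := by
  refine mul_right_injective_of_cube hα h.x_cube ?_
  simp only [x_mul_wSum hα h.x_cube, h.y₂_mul_y₁]
  abel

theorem swap (hρ : ρ ^ 2 + ρ + 1 = 0) : Φ.IsFrame (ρ ^ 2) x y₂ y₁ (ρ • w) := by
  have hρ3 : ρ ^ 3 = 1 := by linear_combination (ρ - 1) * hρ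
  have hρ4 : (ρ ^ 2) ^ 2 = ρ := by linear_combination ρ * hρ3
  refine ⟨⟨h.x_cube, h.y₂_mul_x, by rw [h.y₁_mul_x, hρ4]⟩, ?_, ?_, ?_⟩
  · rw [h.y₁_mul_y₂, wCoeff₁_sq, mul_smul_comm]
  · rw [h.y₂_mul_y₁, wCoeff₁_sq, hρ4, mul_smul_comm, smul_smul, ← mul_assoc, ← pow_succ,
      ← pow_succ', hρ3, one_smul, one_mul]
  · rw [add_comm, h.cubes, hρ4, smul_smul]
    ring_nf

end IsFrame

end Frame

section Presentation

variable {B : Type*} [Ring B] [Algebra F B] {Φ ρ}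

/-- The values `(a, b) = (1, 0), (0, 1), (1, 1), (1, ρ)` separate the four coefficients. -/
theorem forall_relation_iff_isCliffordPair (hρ : IsPrimitiveRoot ρ 3) {X Y : B} :
    (∀ a b : F, (a • X + b • Y) ^ 3 = (Φ.r * b) • (a • X + b • Y) ^ 2
      + (Φ.e * a * b + Φ.t * b ^ 2) • (a • X + b • Y)
      + (Φ.α * a ^ 3 + Φ.β * a ^ 2 * b + Φ.γ * a * b ^ 2 + Φ.δ * b ^ 3) • 1) ↔
    Φ.IsCliffordPair X Y := by
  let E₀ := X * (X * X) - Φ.α • 1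
  let E₁ := X * (X * Y) + X * (Y * X) + Y * (X * X) - (Φ.r • (X * X) + Φ.e • X + Φ.β • 1)
  let E₂ := X * (Y * Y) + Y * (X * Y) + Y * (Y * X)
    - (Φ.r • (X * Y + Y * X) + Φ.e • Y + Φ.t • X + Φ.γ • 1)
  let E₃ := Y * (Y * Y) - (Φ.r • (Y * Y) + Φ.t • Y + Φ.δ • 1)
  have expand (a b : F) : (a • X + b • Y) ^ 3 - ((Φ.r * b) • (a • X + b • Y) ^ 2
      + (Φ.e * a * b + Φ.t * b ^ 2) • (a • X + b • Y)
      + (Φ.α * a ^ 3 + Φ.β * a ^ 2 * b + Φ.γ * a * b ^ 2 + Φ.δ * b ^ 3) • 1)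
      = a ^ 3 • E₀ + (a ^ 2 * b) • E₁ + (a * b ^ 2) • E₂ + b ^ 3 • E₃ := by
    simp only [E₀, E₁, E₂, E₃, pow_succ (_ : B), pow_zero, one_mul, mul_add, add_mul,
      smul_mul_assoc, mul_smul_comm, mul_assoc]
    module
  constructor
  · intro h
    have h' (a b : F) := (expand a b).symm.trans (sub_eq_zero.2 (h a b))
    have h₀ : E₀ = 0 := by simpa using h' 1 0
    have h₃ : E₃ = 0 := by simpa using h' 0 1
    have h₁₂ : E₁ + E₂ = 0 := by simpa [h₀, h₃] using h' 1 1
    have hρ₁₂ : ρ • E₁ + ρ ^ 2 • E₂ = 0 := by simpa [h₀, h₃] using h' 1 ρ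
    have h₂ : E₂ = 0 := by
      have hne : ρ ^ 2 - ρ ≠ 0 := by
        rw [pow_two, ← mul_sub_one]
        exact mul_ne_zero (hρ.ne_zero three_ne_zero) (sub_ne_zero.2 (hρ.ne_one (by norm_num)))
      refine (smul_eq_zero.1 (?_ : (ρ ^ 2 - ρ) • E₂ = 0)).resolve_left hne
      linear_combination (norm := module) hρ₁₂ - ρ • h₁₂
    rw [h₂, add_zero] at h₁₂
    exact ⟨sub_eq_zero.1 h₀, sub_eq_zero.1 h₁₂, sub_eq_zero.1 h₂, sub_eq_zero.1 h₃⟩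
  · intro h a b
    have h₀ : E₀ = 0 := sub_eq_zero.2 h.x_cube
    have h₁ : E₁ = 0 := sub_eq_zero.2 h.linear
    have h₂ : E₂ = 0 := sub_eq_zero.2 h.quadratic
    have h₃ : E₃ = 0 := sub_eq_zero.2 h.y_cube
    simpa [h₀, h₁, h₂, h₃, sub_eq_zero] using expand a b

theorem lift_respects_pappacenaRel_iff (hρ : IsPrimitiveRoot ρ 3) {X Y : B} :
    (∀ ⦃p q : FreeAlgebra F (Fin 2)⦄, PappacenaRel F 2 3 Φ.form p q →
      FreeAlgebra.lift F ![X, Y] p = FreeAlgebra.lift F ![X, Y] q) ↔ Φ.IsCliffordPair X Y := by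
  rw [← forall_relation_iff_isCliffordPair hρ]
  constructor
  · intro h a b
    simpa [form, Finset.sum_Icc_succ_top, Algebra.algebraMap_eq_smul_one] using
      h (PappacenaRel.rel ![a, b])
  · rintro h _ _ ⟨a⟩
    simpa [form, Finset.sum_Icc_succ_top, Algebra.algebraMap_eq_smul_one] using h (a 0) (a 1)

theorem isCliffordPair_x_y (hρ : IsPrimitiveRoot ρ 3) : Φ.IsCliffordPair Φ.x Φ.y := by
  have hlift : FreeAlgebra.lift F ![Φ.x, Φ.y]
      = RingQuot.mkAlgHom F (PappacenaRel F 2 3 Φ.form) := by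
    ext i
    fin_cases i <;> simp [x, y]
  rw [← lift_respects_pappacenaRel_iff hρ, hlift]
  exact fun _ _ hpq => RingQuot.mkAlgHom_rel F hpq

theorem IsCliffordPair.exists_algHom (hρ : IsPrimitiveRoot ρ 3) {X Y : B}
    (h : Φ.IsCliffordPair X Y) : ∃ f : Φ.Alg →ₐ[F] B, f Φ.x = X ∧ f Φ.y = Y :=
  ⟨RingQuot.liftAlgHom F ⟨FreeAlgebra.lift F ![X, Y], (lift_respects_pappacenaRel_iff hρ).2 h⟩,
    by simp [x], by simp [y]⟩

theorem map_yComp (hα : Φ.α ≠ 0) (f : Φ.Alg →ₐ[F] B) (k : ℕ) :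
    f (Φ.yComp ρ k) = eigenComponent (ρ ^ k) Φ.α (f Φ.x) (f Φ.y) := by
  have hxInv : Φ.xInv ^ 2 = Φ.α⁻¹ • Φ.x := by
    calc Φ.xInv ^ 2 = (Φ.α⁻¹ * Φ.α⁻¹) • (Φ.x ^ 3 * Φ.x) := by
          rw [xInv, pow_two, smul_mul_smul_comm]
          noncomm_ring
      _ = Φ.α⁻¹ • Φ.x := by
          rw [x_pow_three, ← Algebra.smul_def, smul_smul, inv_mul_cancel_right₀ hα]
  rw [yComp, hxInv, xInv, eigenComponent]
  simp only [map_smul, map_add, map_mul, mul_smul_comm, smul_smul, pow_two, mul_assoc, mul_comm 2,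
    pow_mul]

theorem map_w (f : Φ.Alg →ₐ[F] B) :
    f (Φ.w ρ) = Φ.wSum ρ (f Φ.x) (f (Φ.yComp ρ 1)) (f (Φ.yComp ρ 2)) := by
  rw [w, xInv, wSum]
  simp only [map_smul, map_add, map_mul, smul_smul, pow_two, mul_assoc, smul_mul_assoc, wCoeff₁,
    wCoeff₂]

section Universal

variable (hρ : IsPrimitiveRoot ρ 3) (hα : Φ.α ≠ 0)

include hρ hα

theorem ySum_yComp : Φ.ySum Φ.x (Φ.yComp ρ 1) (Φ.yComp ρ 2) = Φ.y := by
  have hxy := isCliffordPair_x_y (Φ := Φ) hρ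
  have hk := map_yComp (ρ := ρ) hα (AlgHom.id F Φ.Alg)
  simp only [AlgHom.id_apply] at hk
  rw [ySum, hk, hk, pow_one]
  exact eigenSum_eigenComponent (sq_add_self_add_one_eq_zero hρ)
    (three_ne_zero_of_isPrimitiveRoot hρ) hα hxy.x_cube hxy.linear

theorem isFrame : Φ.IsFrame ρ Φ.x (Φ.yComp ρ 1) (Φ.yComp ρ 2) (Φ.w ρ) := by
  have hxy := isCliffordPair_x_y (Φ := Φ) hρ
  have hρ' := sq_add_self_add_one_eq_zero hρ
  have htriple := isEigenTriple_eigenComponent hρ' hα hxy.x_cube Φ.y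
  have hy₁ : Φ.yComp ρ 1 = eigenComponent ρ Φ.α Φ.x Φ.y := by
    simpa using map_yComp hα (AlgHom.id F Φ.Alg) 1
  have hy₂ : Φ.yComp ρ 2 = eigenComponent (ρ ^ 2) Φ.α Φ.x Φ.y :=
    map_yComp hα (AlgHom.id F Φ.Alg) 2
  have hw : Φ.w ρ = Φ.wSum ρ Φ.x (Φ.yComp ρ 1) (Φ.yComp ρ 2) := map_w (AlgHom.id F Φ.Alg)
  rw [← hy₁, ← hy₂] at htriple
  rw [hw, ← isCliffordPair_ySum_iff hρ' hα (three_ne_zero_of_isPrimitiveRoot hρ) htriple,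
    ySum_yComp hρ hα]
  exact hxy

theorem IsFrame.exists_algHom {X Y₁ Y₂ W : B} (h : Φ.IsFrame ρ X Y₁ Y₂ W) :
    ∃ f : Φ.Alg →ₐ[F] B, f Φ.x = X ∧ f (Φ.yComp ρ 1) = Y₁ ∧ f (Φ.yComp ρ 2) = Y₂ ∧
      f (Φ.w ρ) = W := by
  have hρ' := sq_add_self_add_one_eq_zero hρ
  have h3 := three_ne_zero_of_isPrimitiveRoot hρ
  obtain rfl := h.eq_wSum hα
  obtain ⟨f, hx, hy⟩ :=
    ((isCliffordPair_ySum_iff hρ' hα h3 h.toIsEigenTriple).2 h).exists_algHom hρ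
  obtain ⟨hy₁, hy₂⟩ := h.toIsEigenTriple.eigenComponent_eigenSum hρ' h3 hα (p₀ := Φ.r / 3)
    (p₁ := Φ.β / (3 * Φ.α)) (p₂ := Φ.e / (3 * Φ.α))
  have h₁ : f (Φ.yComp ρ 1) = Y₁ := by rw [map_yComp hα, hx, hy, pow_one, ySum, hy₁]
  have h₂ : f (Φ.yComp ρ 2) = Y₂ := by rw [map_yComp hα, hx, hy, ySum, hy₂]
  exact ⟨f, hx, h₁, h₂, by rw [map_w, hx, h₁, h₂]⟩

end Universal

end Presentation

section FrameCommutation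

variable {B : Type*} [Ring B] [Algebra F B] {Φ ρ} {x y₁ y₂ w : B}

namespace IsFrame

variable (h : Φ.IsFrame ρ x y₁ y₂ w)

include h

theorem x_pow_three : x ^ 3 = algebraMap F B Φ.α := by
  rw [Algebra.algebraMap_eq_smul_one, ← h.x_cube, pow_succ', pow_two]

theorem y₂_mul_y₁_mul (z : B) :
    y₂ * (y₁ * z) = x * (w * z) - Φ.wCoeff₁ ρ • (x * (x * z)) - Φ.wCoeff₂ • z := by
  rw [← mul_assoc, h.y₂_mul_y₁]
  simp only [sub_mul, smul_mul_assoc, mul_assoc, one_mul]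

theorem y₁_mul_y₂_mul (z : B) :
    y₁ * (y₂ * z)
      = ρ • (x * (w * z)) - (ρ ^ 2 * Φ.wCoeff₁ ρ) • (x * (x * z)) - Φ.wCoeff₂ • z := by
  rw [← mul_assoc, h.y₁_mul_y₂]
  simp only [sub_mul, smul_mul_assoc, mul_assoc, one_mul]

theorem y₂_cube_eq : y₂ ^ 3 = (ρ ^ 2 * Φ.e) • w - Φ.D • 1 - y₁ ^ 3 := by
  rw [← h.cubes]
  noncomm_ring

variable (hρ : ρ ^ 2 + ρ + 1 = 0)

include hρ

theorem commute_y₁_cube_x : Commute (y₁ ^ 3) x := by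
  have hρ3 : ρ ^ 3 = 1 := by linear_combination (ρ - 1) * hρ
  rw [commute_iff_eq, pow_mul_of_mul_eq_smul h.y₁_mul_x, hρ3, one_smul]

variable (hα : Φ.α ≠ 0)

include hα

theorem commute_w_x : Commute w x := by
  refine (mul_right_injective_of_cube hα h.x_cube ?_).symm
  have hyy : y₂ * y₁ * x = x * (y₂ * y₁) := by
    rw [mul_assoc, h.y₁_mul_x, mul_smul_comm, mul_mul_eq_smul h.y₂_mul_x, smul_smul, ← pow_succ',
      show ρ ^ 3 = 1 by linear_combination (ρ - 1) * hρ, one_smul]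
  rw [h.y₂_mul_y₁] at hyy
  simp only [sub_mul, mul_sub, smul_mul_assoc, mul_smul_comm, mul_assoc, one_mul, mul_one,
    sub_left_inj] at hyy
  exact hyy.symm

/-- This is the associativity `y₁ (y₂ y₁) = (y₁ y₂) y₁`. -/
theorem commute_w_y₁ : Commute w y₁ := by
  have hyy := congrArg (y₁ * ·) h.y₂_mul_y₁
  simp only [h.y₁_mul_y₂_mul, mul_sub, mul_smul_comm, mul_one, mul_mul_eq_smul h.y₁_mul_x,
    h.y₁_mul_x, smul_smul, sub_left_inj] at hyy
  rw [show Φ.wCoeff₁ ρ * (ρ * ρ) = ρ ^ 2 * Φ.wCoeff₁ ρ by ring, sub_left_inj] at hyy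
  have hρ0 : ρ ≠ 0 := by
    rintro rfl
    simp at hρ
  exact mul_right_injective_of_cube hα h.x_cube (smul_right_injective B hρ0 hyy)

theorem commute_w_y₂ : Commute w y₂ := by
  have hw := ((h.swap hρ).commute_w_y₁ (by linear_combination (ρ ^ 2 - ρ + 1) * hρ) hα).smul_left
    (ρ ^ 2)
  rwa [smul_smul, show ρ ^ 2 * ρ = 1 by linear_combination (ρ - 1) * hρ, one_smul] at hw

theorem commute_y₂_cube_y₁ : Commute (y₂ ^ 3) y₁ := by
  rw [h.y₂_cube_eq]
  exact (((h.commute_w_y₁ hρ hα).smul_left _).sub_left ((Commute.one_left _).smul_left _)).sub_left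
    ((Commute.refl _).pow_left 3)

theorem commute_y₁_cube_y₂ : Commute (y₁ ^ 3) y₂ :=
  (h.swap hρ).commute_y₂_cube_y₁ (by linear_combination (ρ ^ 2 - ρ + 1) * hρ) hα

theorem y₂_cube_mul_y₁_cube :
    y₂ ^ 3 * y₁ ^ 3 = Φ.α • w ^ 3 - (Φ.α ^ 2 * Φ.wCoeff₁ ρ ^ 3 + Φ.wCoeff₂ ^ 3) • 1
      - (3 * Φ.α * Φ.wCoeff₁ ρ * Φ.wCoeff₂) • w :=
  cube_mul_cube_eq_norm hρ h.x_cube h.y₂_mul_x h.y₂_mul_y₁ (h.commute_w_x hρ hα)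
    (h.commute_w_y₂ hρ hα)

end IsFrame

end FrameCommutation

section Curve

open Polynomial in
/-- The polynomial whose value at `R` is the norm of `R x - c₁ x² - c₂` from the cubic extension
generated by a root `x` of `X³ - α`, where `c₁ = wCoeff₁ Φ ρ` and `c₂ = wCoeff₂ Φ`. -/
noncomputable def normPoly : F[X] :=
  C Φ.α * X ^ 3 - C (3 * Φ.α * Φ.wCoeff₁ ρ * Φ.wCoeff₂) * X
    - C (Φ.α ^ 2 * Φ.wCoeff₁ ρ ^ 3 + Φ.wCoeff₂ ^ 3)

/-- The second root, besides `S`, of the equation of `E`, which is quadratic in `S`. -/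
noncomputable def otherRoot {A : Type*} [CommRing A] [Algebra F A] (R S : A) : A :=
  algebraMap F A (ρ ^ 2 * Φ.e) * R - algebraMap F A Φ.D - S

variable {Φ ρ}

theorem aeval_normPoly {A : Type*} [Ring A] [Algebra F A] (R : A) :
    Polynomial.aeval R (Φ.normPoly ρ) = Φ.α • R ^ 3
      - (Φ.α ^ 2 * Φ.wCoeff₁ ρ ^ 3 + Φ.wCoeff₂ ^ 3) • 1
      - (3 * Φ.α * Φ.wCoeff₁ ρ * Φ.wCoeff₂) • R := by
  simp only [normPoly, map_sub, map_add, map_mul, map_pow, Polynomial.aeval_C, Polynomial.aeval_X,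
    Algebra.smul_def, mul_one]
  abel

theorem aeval_smul_normPoly_sq {A : Type*} [Ring A] [Algebra F A] (hρ : ρ ^ 3 = 1) (R : A) :
    Polynomial.aeval (ρ • R) (Φ.normPoly (ρ ^ 2)) = Polynomial.aeval R (Φ.normPoly ρ) := by
  have hconst : Φ.α ^ 2 * (ρ ^ 2 * Φ.wCoeff₁ ρ) ^ 3 + Φ.wCoeff₂ ^ 3
      = Φ.α ^ 2 * Φ.wCoeff₁ ρ ^ 3 + Φ.wCoeff₂ ^ 3 := by
    linear_combination Φ.α ^ 2 * Φ.wCoeff₁ ρ ^ 3 * (ρ ^ 3 + 1) * hρ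
  have hlin : 3 * Φ.α * (ρ ^ 2 * Φ.wCoeff₁ ρ) * Φ.wCoeff₂ * ρ
      = 3 * Φ.α * Φ.wCoeff₁ ρ * Φ.wCoeff₂ := by
    linear_combination 3 * Φ.α * Φ.wCoeff₁ ρ * Φ.wCoeff₂ * hρ
  rw [aeval_normPoly, aeval_normPoly, wCoeff₁_sq, hconst, smul_pow, hρ, one_smul, smul_smul, hlin]

theorem eval_normPoly_ne_zero (hρ : ρ ^ 2 + ρ + 1 = 0)
    (hα : IsField (AdjoinRoot (Polynomial.X ^ 3 - Polynomial.C Φ.α))) {c : F} (hc : c ≠ 0) :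
    (Φ.normPoly ρ).eval c ≠ 0 := by
  intro h
  refine hc (eq_zero_of_norm_eq_zero (A := -Φ.wCoeff₂) (C' := -Φ.wCoeff₁ ρ) hρ hα ?_).2.1
  simp only [normPoly, Polynomial.eval_sub, Polynomial.eval_mul, Polynomial.eval_pow,
    Polynomial.eval_C, Polynomial.eval_X] at h
  linear_combination h

theorem map_otherRoot {A B : Type*} [CommRing A] [Algebra F A] [CommRing B] [Algebra F B]
    (f : A →ₐ[F] B) (R S : A) : f (Φ.otherRoot ρ R S) = Φ.otherRoot ρ (f R) (f S) := by
  simp only [otherRoot, map_sub, map_mul, AlgHom.commutes]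

theorem aeval_curve (hρ : IsPrimitiveRoot ρ 3) (hα : Φ.α ≠ 0) {A : Type*} [CommRing A]
    [Algebra F A] (P : Fin 2 → A) : MvPolynomial.aeval P (Φ.curve ρ)
      = Polynomial.aeval (P 0) (Φ.normPoly ρ) - P 1 * Φ.otherRoot ρ (P 0) (P 1) := by
  have h3 := three_ne_zero_of_isPrimitiveRoot hρ
  have h9 : (9 : F) ≠ 0 := by convert pow_ne_zero 2 h3 using 1; norm_num
  have h27 : (27 : F) ≠ 0 := by convert pow_ne_zero 3 h3 using 1; norm_num
  have h729 : (729 : F) ≠ 0 := by convert pow_ne_zero 6 h3 using 1; norm_num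
  have hcoeff₁ : Φ.D₁ ^ 3 / (27 * Φ.α) = Φ.α ^ 2 * Φ.wCoeff₁ ρ ^ 3 := by
    rw [wCoeff₁]
    field_simp
    linear_combination (-27 * Φ.D₁ ^ 3 * (ρ ^ 3 + 1)) * hρ.pow_eq_one
  have hcoeff₂ : Φ.D₂ ^ 3 / (729 * Φ.α ^ 3) = Φ.wCoeff₂ ^ 3 := by
    rw [wCoeff₂]
    field_simp
    norm_num
  have hcoeff₃ : ρ ^ 2 * Φ.D₁ * Φ.D₂ / (9 * Φ.α) = 3 * Φ.α * Φ.wCoeff₁ ρ * Φ.wCoeff₂ := by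
    rw [wCoeff₁, wCoeff₂]
    field_simp
  rw [curve, hcoeff₁, hcoeff₂, hcoeff₃]
  simp only [normPoly, otherRoot, map_add, map_sub, map_mul, map_pow, MvPolynomial.aeval_X,
    MvPolynomial.aeval_C, Polynomial.aeval_C, Polynomial.aeval_X]
  ring

theorem aeval_curve_eq_zero_iff (hρ : IsPrimitiveRoot ρ 3) (hα : Φ.α ≠ 0) {A : Type*} [CommRing A]
    [Algebra F A] {P : Fin 2 → A} : MvPolynomial.aeval P (Φ.curve ρ) = 0 ↔
      P 1 * Φ.otherRoot ρ (P 0) (P 1) = Polynomial.aeval (P 0) (Φ.normPoly ρ) := by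
  rw [aeval_curve hρ hα, sub_eq_zero, eq_comm]

/-- Evaluation of functions on `E` at a point with coordinates in a commutative algebra. -/
noncomputable def evalPoint {A : Type*} [CommRing A] [Algebra F A] {P : Fin 2 → A}
    (hP : MvPolynomial.aeval P (Φ.curve ρ) = 0) : Φ.CoordRing ρ →ₐ[F] A :=
  Ideal.Quotient.liftₐ _ (MvPolynomial.aeval P) fun _ ha =>
    (Ideal.span_singleton_le_iff_mem (RingHom.ker (MvPolynomial.aeval P))).2 hP ha

theorem evalPoint_coord {A : Type*} [CommRing A] [Algebra F A] {P : Fin 2 → A}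
    (hP : MvPolynomial.aeval P (Φ.curve ρ) = 0) (i : Fin 2) :
    evalPoint hP (Φ.coord ρ i) = P i :=
  MvPolynomial.aeval_X _ i

theorem aeval_coord_eq_mk :
    MvPolynomial.aeval (Φ.coord ρ) = Ideal.Quotient.mkₐ F (Ideal.span {Φ.curve ρ}) := by
  ext i
  simp [coord]

theorem adjoin_range_coord : Algebra.adjoin F (Set.range (Φ.coord ρ)) = ⊤ := by
  rw [Algebra.adjoin_range_eq_range_aeval, aeval_coord_eq_mk, AlgHom.range_eq_top]
  exact Ideal.Quotient.mkₐ_surjective F _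

theorem coordRing_algHom_ext {A : Type*} [Ring A] [Algebra F A] {f g : Φ.CoordRing ρ →ₐ[F] A}
    (h : ∀ i, f (Φ.coord ρ i) = g (Φ.coord ρ i)) : f = g :=
  AlgHom.ext_of_adjoin_eq_top adjoin_range_coord (Set.forall_mem_range.2 h)

theorem aeval_coord_curve : MvPolynomial.aeval (Φ.coord ρ) (Φ.curve ρ) = 0 := by
  rw [aeval_coord_eq_mk, Ideal.Quotient.mkₐ_eq_mk, Ideal.Quotient.eq_zero_iff_mem]
  exact Ideal.mem_span_singleton_self _

end Curve

section GeneratingFrame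

variable {B R : Type*} [Ring B] [Algebra F B] [CommRing R] [Algebra F R] [Algebra R B]
  [IsScalarTower F R B] {Φ ρ} {x y₁ y₂ w : B} {w' : R} {s : Fin 2 → R}

namespace IsFrame

variable (h : Φ.IsFrame ρ x y₁ y₂ w)

include h

theorem mul_pow_mul_pow_mem (hw : w = algebraMap R B w') {M : Submodule R B}
    (h₁ : ∀ p q, x ^ p * y₁ ^ q ∈ M) (h₂ : ∀ p, x ^ p * y₂ ∈ M) (p q : ℕ) :
    x * (x ^ p * y₁ ^ q) ∈ M ∧ y₁ * (x ^ p * y₁ ^ q) ∈ M ∧ y₂ * (x ^ p * y₁ ^ q) ∈ M := by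
  have hF (c : F) {m : B} (hm : m ∈ M) : c • m ∈ M := (M.restrictScalars F).smul_mem c hm
  refine ⟨?_, ?_, ?_⟩
  · rw [← mul_assoc, ← pow_succ']
    exact h₁ _ _
  · rw [← mul_assoc, mul_pow_of_mul_eq_smul h.y₁_mul_x, smul_mul_assoc, mul_assoc, ← pow_succ']
    exact hF _ (h₁ _ _)
  · rw [← mul_assoc, mul_pow_of_mul_eq_smul h.y₂_mul_x, smul_mul_assoc, mul_assoc]
    refine hF _ ?_
    cases q with
    | zero => simpa using h₂ p
    | succ q =>
      have hxx (z : B) : x ^ p * (x * z) = x ^ (p + 1) * z := by rw [← mul_assoc, pow_succ]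
      have hxx₂ (z : B) : x ^ (p + 1) * (x * z) = x ^ (p + 2) * z := by rw [← mul_assoc, ← pow_succ]
      rw [pow_succ', h.y₂_mul_y₁_mul, hw, ← Algebra.smul_def]
      simp only [mul_sub, mul_smul_comm, hxx, hxx₂]
      exact sub_mem (sub_mem (M.smul_mem _ (h₁ _ _)) (hF _ (h₁ _ _))) (hF _ (h₁ _ _))

variable (hρ : IsPrimitiveRoot ρ 3) (hs : ∀ i, ![y₁, y₂] i ^ 3 = algebraMap R B (s i))

include hρ hs

omit [Algebra F R] [IsScalarTower F R B] in
theorem isSymbolPair (i : Fin 2) : IsSymbolPair 3 (![ρ, ρ ^ 2] i) x (![y₁, y₂] i) where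
  isPrimitiveRoot := by
    fin_cases i
    exacts [hρ, hρ.pow_of_coprime 2 (by norm_num)]
  v_mul_u := by
    fin_cases i
    exacts [h.y₁_mul_x, h.y₂_mul_x]
  commute_u_pow c := h.x_pow_three ▸ Algebra.commute_algebraMap_left _ c
  commute_v_pow c := hs i ▸ Algebra.commute_algebraMap_left _ c

variable (hw : w = algebraMap R B w') (hgen : Algebra.adjoin F {x, y₁, y₂} = ⊤)

include hw hgen

theorem span_symbolMon_eq_top :
    Submodule.span R (Set.range fun j : Fin 2 × _ => symbolMon 3 x (![y₁, y₂] j.1) j.2) = ⊤ := by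
  have hx : x ^ 3 = algebraMap R B (algebraMap F R Φ.α) := by
    rw [h.x_pow_three, IsScalarTower.algebraMap_apply F R B]
  set M := Submodule.span R
    (Set.range fun j : Fin 2 × _ => symbolMon 3 x (![y₁, y₂] j.1) j.2)
  have hpow (i : Fin 2) (p q : ℕ) : x ^ p * ![y₁, y₂] i ^ q ∈ M := by
    refine Submodule.span_mono ?_ (pow_mul_pow_mem_span_symbolMon hx (hs i) p q)
    rintro _ ⟨j, rfl⟩
    exact ⟨(i, j), rfl⟩
  have hmem := h.mul_pow_mul_pow_mem hw (hpow 0) fun p => by simpa using hpow 1 p 1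
  have hmem' := (h.swap (sq_add_self_add_one_eq_zero hρ)).mul_pow_mul_pow_mem (w' := ρ • w')
    (by rw [hw, ← algebraMap.smul]) (hpow 1) fun p => by simpa using hpow 0 p 1
  refine span_eq_top_of_adjoin_eq_top hgen (by simpa using hpow 0 0 0) ?_
  rintro g (rfl | rfl | rfl) _ ⟨⟨j, p, q⟩, rfl⟩ <;> fin_cases j
  exacts [(hmem p q).1, (hmem' p q).1, (hmem p q).2.1, (hmem' p q).2.2, (hmem p q).2.2,
    (hmem' p q).2.1]

theorem isSymbolCover (hα : Φ.α ≠ 0) (hcop : IsCoprime (s 0) (s 1)) :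
    IsSymbolCover R 3 ![ρ, ρ ^ 2] (fun _ => x) ![y₁, y₂]
      fun i => 3 ^ 2 • (s i * algebraMap F R Φ.α) := by
  have hpair := h.isSymbolPair hρ hs
  have ht (i : Fin 2) : 3 ^ 2 • (![y₁, y₂] i ^ 3 * x ^ 3)
      = algebraMap R B (3 ^ 2 • (s i * algebraMap F R Φ.α)) := by
    rw [map_nsmul, map_mul, hs, h.x_pow_three, IsScalarTower.algebraMap_apply F R B]
  refine ⟨hpair, ?_, fun i => by rw [(hpair i).conjSum_one, ht], ?_⟩
  · have hunit : IsUnit (3 ^ 2 • algebraMap F R Φ.α) := by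
      rw [nsmul_eq_mul, ← map_natCast (algebraMap F R), ← map_mul]
      refine (IsUnit.mk0 _ (mul_ne_zero ?_ hα)).map _
      exact_mod_cast pow_ne_zero 2 (three_ne_zero_of_isPrimitiveRoot hρ)
    obtain ⟨a, b, hab⟩ := (isCoprime_mul_unit_right hunit _ _).2 hcop
    simp only [← mul_smul_comm, Ideal.eq_top_iff_one, ← hab]
    exact add_mem (Ideal.mul_mem_left _ _ (Ideal.subset_span ⟨0, rfl⟩))
      (Ideal.mul_mem_left _ _ (Ideal.subset_span ⟨1, rfl⟩))
  · refine exists_conjSum_of_span_eq_top (h.span_symbolMon_eq_top hρ hs hw hgen) ?_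
    rintro _ ⟨⟨j, m⟩, rfl⟩
    refine ⟨if m = 0 then 1 else 0, fun i => ?_⟩
    have hj := h.isSymbolPair hρ hs j
    rw [(hpair i).conjSum_symbolMon_of_mul_u hj.isPrimitiveRoot hj.v_mul_u, ht]
    split_ifs <;> simp

end IsFrame

end GeneratingFrame

/-- The standing assumptions: `ρ` is a primitive cube root of unity, `X³ - α` is irreducible and
`D` does not vanish. -/
structure IsAdmissible : Prop where
  isPrimitiveRoot : IsPrimitiveRoot ρ 3
  isField : IsField (AdjoinRoot (Polynomial.X ^ 3 - Polynomial.C Φ.α))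
  D_ne_zero : Φ.D ≠ 0

namespace IsAdmissible

variable {Φ ρ} (H : Φ.IsAdmissible ρ)

include H

theorem sq_add_self_add_one : ρ ^ 2 + ρ + 1 = 0 := sq_add_self_add_one_eq_zero H.isPrimitiveRoot

theorem α_ne_zero : Φ.α ≠ 0 := ne_zero_of_isField_adjoinRoot H.isField

theorem isFrame : Φ.IsFrame ρ Φ.x (Φ.yComp ρ 1) (Φ.yComp ρ 2) (Φ.w ρ) :=
  Coeffs.isFrame H.isPrimitiveRoot H.α_ne_zero

theorem adjoin_eq_top : Algebra.adjoin F {Φ.x, Φ.yComp ρ 1, Φ.yComp ρ 2} = ⊤ := by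
  rw [eq_top_iff, ← adjoin_mkAlgHom_ι (PappacenaRel F 2 3 Φ.form), Algebra.adjoin_le_iff]
  set S := Algebra.adjoin F {Φ.x, Φ.yComp ρ 1, Φ.yComp ρ 2}
  have hx : Φ.x ∈ S := Algebra.subset_adjoin (by simp)
  have hy₁ : Φ.yComp ρ 1 ∈ S := Algebra.subset_adjoin (by simp)
  have hy₂ : Φ.yComp ρ 2 ∈ S := Algebra.subset_adjoin (by simp)
  have hy : Φ.y ∈ S := by
    rw [← ySum_yComp (Φ := Φ) H.isPrimitiveRoot H.α_ne_zero, ySum, eigenSum]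
    exact add_mem (add_mem (add_mem (add_mem (S.smul_mem (one_mem S) _) (S.smul_mem hx _))
      (S.smul_mem (mul_mem hx hx) _)) hy₁) hy₂
  rintro _ ⟨i, rfl⟩
  fin_cases i
  exacts [hx, hy]

theorem commute_of_commute_generators {z : Φ.Alg} (hx : Commute z Φ.x)
    (hy₁ : Commute z (Φ.yComp ρ 1)) (hy₂ : Commute z (Φ.yComp ρ 2)) (c : Φ.Alg) : Commute z c := by
  have hle : Algebra.adjoin F {Φ.x, Φ.yComp ρ 1, Φ.yComp ρ 2} ≤ Subalgebra.centralizer F {z} := by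
    rw [Algebra.adjoin_le_iff]
    rintro g (rfl | rfl | rfl) _ rfl
    exacts [hx, hy₁, hy₂]
  exact hle (H.adjoin_eq_top ▸ Algebra.mem_top) z rfl

theorem w_mem_center : Φ.w ρ ∈ Subalgebra.center F Φ.Alg :=
  have hρ := H.sq_add_self_add_one
  Subalgebra.mem_center_iff.2 fun c => (H.commute_of_commute_generators
    (H.isFrame.commute_w_x hρ H.α_ne_zero) (H.isFrame.commute_w_y₁ hρ H.α_ne_zero)
    (H.isFrame.commute_w_y₂ hρ H.α_ne_zero) c).symm.eq

theorem y₁_cube_mem_center : Φ.yComp ρ 1 ^ 3 ∈ Subalgebra.center F Φ.Alg :=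
  have hρ := H.sq_add_self_add_one
  Subalgebra.mem_center_iff.2 fun c => (H.commute_of_commute_generators
    (H.isFrame.commute_y₁_cube_x hρ) ((Commute.refl _).pow_left 3)
    (H.isFrame.commute_y₁_cube_y₂ hρ H.α_ne_zero) c).symm.eq

/-- The point of `E` over the center of `C_Φ` given by `w` and `y₁³`. -/
noncomputable def centerPoint : Fin 2 → Subalgebra.center F Φ.Alg :=
  ![⟨Φ.w ρ, H.w_mem_center⟩, ⟨Φ.yComp ρ 1 ^ 3, H.y₁_cube_mem_center⟩]

theorem otherRoot_centerPoint :
    ((Φ.otherRoot ρ (H.centerPoint 0) (H.centerPoint 1) : Subalgebra.center F Φ.Alg) : Φ.Alg)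
      = Φ.yComp ρ 2 ^ 3 := by
  rw [H.isFrame.y₂_cube_eq, Algebra.smul_def, ← Algebra.algebraMap_eq_smul_one]
  rfl

theorem aeval_centerPoint_curve : MvPolynomial.aeval H.centerPoint (Φ.curve ρ) = 0 := by
  refine (aeval_curve_eq_zero_iff (A := Subalgebra.center F Φ.Alg) H.isPrimitiveRoot
    H.α_ne_zero).2 ((mul_comm _ _).trans ?_)
  refine Subtype.ext (.trans ?_ (Polynomial.aeval_subalgebra_coe _ _ _).symm)
  rw [aeval_normPoly]
  exact (congrArg (· * _) H.otherRoot_centerPoint).trans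
    (H.isFrame.y₂_cube_mul_y₁_cube H.sq_add_self_add_one H.α_ne_zero)

/-- The homomorphism `F[E] → Z(C_Φ)` with `R ↦ w` and `S ↦ y₁³`. -/
noncomputable def toCenter : Φ.CoordRing ρ →ₐ[F] Subalgebra.center F Φ.Alg :=
  evalPoint (A := Subalgebra.center F Φ.Alg) H.aeval_centerPoint_curve

theorem toCenter_coord (i : Fin 2) : H.toCenter (Φ.coord ρ i) = H.centerPoint i :=
  MvPolynomial.aeval_X _ i

/-- The structure of `F[E]`-algebra on `C_Φ`. -/
noncomputable abbrev algebraCoordRing : Algebra (Φ.CoordRing ρ) Φ.Alg :=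
  ((Subalgebra.center F Φ.Alg).val.comp H.toCenter).toRingHom.toAlgebra'
    fun κ c => (Subalgebra.mem_center_iff.1 (H.toCenter κ).2 c).symm

theorem toCenter_otherRoot :
    (H.toCenter (Φ.otherRoot ρ (Φ.coord ρ 0) (Φ.coord ρ 1)) : Φ.Alg) = Φ.yComp ρ 2 ^ 3 := by
  rw [← H.otherRoot_centerPoint, ← H.toCenter_coord, ← H.toCenter_coord]
  exact congrArg Subtype.val (map_otherRoot (B := Subalgebra.center F Φ.Alg) H.toCenter _ _)

theorem isCoprime_coord_otherRoot :
    IsCoprime (Φ.coord ρ 1) (Φ.otherRoot ρ (Φ.coord ρ 0) (Φ.coord ρ 1)) :=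
  isCoprime_of_mul_eq_aeval (fun _ => eval_normPoly_ne_zero H.sq_add_self_add_one H.isField)
    H.D_ne_zero (add_sub_cancel _ _)
    ((aeval_curve_eq_zero_iff H.isPrimitiveRoot H.α_ne_zero).1 aeval_coord_curve)

theorem isSymbolCover : letI := H.algebraCoordRing
    IsSymbolCover (Φ.CoordRing ρ) 3 ![ρ, ρ ^ 2] (fun _ => Φ.x) ![Φ.yComp ρ 1, Φ.yComp ρ 2]
      fun i => 3 ^ 2 • (![Φ.coord ρ 1, Φ.otherRoot ρ (Φ.coord ρ 0) (Φ.coord ρ 1)] i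
        * algebraMap F (Φ.CoordRing ρ) Φ.α) := by
  let := H.algebraCoordRing
  have : IsScalarTower F (Φ.CoordRing ρ) Φ.Alg := IsScalarTower.of_algebraMap_eq fun r =>
    (((Subalgebra.center F Φ.Alg).val.comp H.toCenter).commutes r).symm
  have hw : Φ.w ρ = algebraMap (Φ.CoordRing ρ) Φ.Alg (Φ.coord ρ 0) :=
    (congrArg Subtype.val (H.toCenter_coord 0)).symm
  refine H.isFrame.isSymbolCover H.isPrimitiveRoot (fun i => ?_) hw H.adjoin_eq_top H.α_ne_zero
    H.isCoprime_coord_otherRoot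
  fin_cases i
  exacts [(congrArg Subtype.val (H.toCenter_coord 1)).symm, H.toCenter_otherRoot.symm]

theorem toCenter_surjective : Function.Surjective H.toCenter := by
  let := H.algebraCoordRing
  intro z
  obtain ⟨κ, hκ⟩ := H.isSymbolCover.mem_range_algebraMap fun c =>
    (Subalgebra.mem_center_iff.1 z.2 c).symm
  exact ⟨κ, Subtype.ext hκ⟩

end IsAdmissible

section FrameConstruction

variable {B : Type*} [Ring B] [Algebra F B] {Φ ρ} {X Y W : B}

namespace IsFrame

variable (hX : X * (X * X) = Φ.α • 1) (hY : IsUnit Y) (hWX : Commute W X) (hWY : Commute W Y)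
  (hnorm : ((ρ ^ 2 * Φ.e) • W - Φ.D • 1 - Y ^ 3) * Y ^ 3 = Polynomial.aeval W (Φ.normPoly ρ))

include hX hY hWX hWY hnorm

theorem exists_of_isUnit_y₁ (hρ : ρ ^ 2 + ρ + 1 = 0) (hYX : Y * X = ρ • (X * Y)) :
    ∃ Z, Φ.IsFrame ρ X Y Z W := by
  obtain ⟨Y, rfl⟩ := hY
  set T := X * W - Φ.wCoeff₁ ρ • (X * X) - Φ.wCoeff₂ • (1 : B) with hT
  have hZY : T * ↑Y⁻¹ * ↑Y = T := Units.inv_mul_cancel_right _ _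
  have hYT : ↑Y * T
      = (ρ • (X * W) - (ρ ^ 2 * Φ.wCoeff₁ ρ) • (X * X) - Φ.wCoeff₂ • 1) * ↑Y := by
    simp only [hT, mul_sub, sub_mul, mul_smul_comm, smul_mul_assoc, mul_mul_eq_smul hYX, hYX,
      ← hWY.eq, mul_assoc, smul_smul, mul_one, one_mul]
    rw [mul_comm (Φ.wCoeff₁ ρ), pow_two]
  have hInvX : ↑Y⁻¹ * X = ρ ^ 2 • (X * ↑Y⁻¹) := by
    rw [Units.inv_mul_eq_iff_eq_mul, mul_smul_comm, ← mul_assoc, hYX, smul_mul_assoc,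
      Units.mul_inv_cancel_right, smul_smul, ← pow_succ,
      show ρ ^ 3 = 1 by linear_combination (ρ - 1) * hρ, one_smul]
  have hTX : T * X = X * T := by
    simp only [hT, mul_sub, sub_mul, mul_smul_comm, smul_mul_assoc, mul_assoc, hWX.eq, mul_one,
      one_mul]
  have hZX : T * ↑Y⁻¹ * X = ρ ^ 2 • (X * (T * ↑Y⁻¹)) := by
    rw [mul_assoc, hInvX, mul_smul_comm, ← mul_assoc, hTX, mul_assoc]
  have hWT : Commute W T := ((hWX.mul_right (Commute.refl W)).sub_right
    ((hWX.mul_right hWX).smul_right _)).sub_right ((Commute.one_right W).smul_right _)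
  have hcube : (T * ↑Y⁻¹) ^ 3 = (ρ ^ 2 * Φ.e) • W - Φ.D • 1 - (Y : B) ^ 3 :=
    (Y ^ 3).isUnit.mul_right_cancel <| by
      rw [Units.val_pow_eq_pow_val, hnorm, aeval_normPoly]
      exact cube_mul_cube_eq_norm hρ hX hZX hZY hWX (hWT.mul_right hWY.units_inv_right)
  refine ⟨T * ↑Y⁻¹, ⟨hX, hYX, hZX⟩, hZY, ?_, ?_⟩
  · rw [← mul_assoc, hYT, Units.mul_inv_cancel_right]
  · rw [← pow_two, ← pow_two, ← pow_succ', ← pow_succ', hcube, add_sub_cancel]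

theorem exists_of_isUnit_y₂ (hρ : ρ ^ 2 + ρ + 1 = 0) (hYX : Y * X = ρ ^ 2 • (X * Y)) :
    ∃ Z, Φ.IsFrame ρ X Z Y W := by
  have hρ3 : ρ ^ 3 = 1 := by linear_combination (ρ - 1) * hρ
  have hρ' : (ρ ^ 2) ^ 2 + ρ ^ 2 + 1 = 0 := by linear_combination (ρ ^ 2 - ρ + 1) * hρ
  have he : ((ρ ^ 2) ^ 2 * Φ.e) • ρ • W = (ρ ^ 2 * Φ.e) • W := by
    rw [smul_smul]
    congr 1
    linear_combination ρ ^ 2 * Φ.e * hρ3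
  obtain ⟨Z, hZ⟩ := exists_of_isUnit_y₁ hX hY (hWX.smul_left ρ) (hWY.smul_left ρ)
    (by rw [he, hnorm, aeval_smul_normPoly_sq hρ3]) hρ' hYX
  have hZ' := hZ.swap hρ'
  rw [smul_smul, ← pow_succ, hρ3, one_smul,
    show (ρ ^ 2) ^ 2 = ρ by linear_combination ρ * hρ3] at hZ'
  exact ⟨Z, hZ'⟩

end IsFrame

end FrameConstruction

theorem surjective_of_adjoin_eq_top {K A B : Type*} [Field K] [Algebra F K] [Ring A] [Algebra F A]
    [Ring B] [Algebra F B] [Algebra K B] [IsScalarTower F K B] {f : A →ₐ[F] B} {s : Set B}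
    {t : Set K} (hs : Algebra.adjoin K s = ⊤) (ht : Algebra.adjoin F t = ⊤)
    (hsf : s ⊆ f.range) (htf : ∀ z ∈ t, algebraMap K B z ∈ f.range) : Function.Surjective f := by
  have hK (z : K) : algebraMap K B z ∈ f.range := by
    have hle : Algebra.adjoin F t ≤ f.range.comap (IsScalarTower.toAlgHom F K B) :=
      Algebra.adjoin_le_iff.2 htf
    exact hle (ht ▸ Algebra.mem_top)
  intro b
  have hb : b ∈ Algebra.adjoin K s := hs ▸ Algebra.mem_top
  change b ∈ f.range
  induction hb using Algebra.adjoin_induction with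
  | mem b hb => exact hsf hb
  | algebraMap z => exact hK z
  | add b c _ _ hb hc => exact add_mem hb hc
  | mul b c _ _ hb hc => exact mul_mem hb hc

section Fibre

variable {K : Type*} [Field K] [Algebra F K]

/-- `(a, b)_{3, K}` is central simple of degree `3` and is an image of `C_Φ` in which `w` and `y₁³`
become the coordinates of the point `P`. -/
def IsFibre (P : Fin 2 → K) (a b : K) : Prop :=
  IsCentralSimpleOfDegree K (SymbolAlgebra K 3 (algebraMap F K ρ) a b) 3 ∧
    ∃ f : Φ.Alg →ₐ[F] SymbolAlgebra K 3 (algebraMap F K ρ) a b, Function.Surjective f ∧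
      f (Φ.w ρ) = algebraMap K _ (P 0) ∧ f (Φ.yComp ρ 1 ^ 3) = algebraMap K _ (P 1)

theorem mul_mul_self_of_cube_eq_algebraMap {B : Type*} [Ring B] [Algebra F B] [Algebra K B]
    [IsScalarTower F K B] {z : B} {c : F} (hz : z ^ 3 = algebraMap K B (algebraMap F K c)) :
    z * (z * z) = c • 1 := by
  rw [← pow_two, ← pow_succ', hz, ← IsScalarTower.algebraMap_apply, Algebra.algebraMap_eq_smul_one]

namespace IsAdmissible

variable {Φ ρ} (H : Φ.IsAdmissible ρ) {P : Fin 2 → K}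
  (hP : MvPolynomial.aeval P (Φ.curve ρ) = 0)

include H hP

theorem otherRoot_ne_zero (hS : P 1 = 0) : Φ.otherRoot ρ (P 0) (P 1) ≠ 0 := by
  intro hS'
  have hcop := H.isCoprime_coord_otherRoot.map (evalPoint hP).toRingHom
  simp only [AlgHom.toRingHom_eq_coe, RingHom.coe_coe, map_otherRoot, evalPoint_coord] at hcop
  rw [hS', hS] at hcop
  exact not_isCoprime_zero_zero hcop

theorem map_otherRoot_mul {B : Type*} [Ring B] [Algebra F B] (g : K →ₐ[F] B) :
    ((ρ ^ 2 * Φ.e) • g (P 0) - Φ.D • 1 - g (P 1)) * g (P 1)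
      = Polynomial.aeval (g (P 0)) (Φ.normPoly ρ) := by
  rw [Polynomial.aeval_algHom_apply,
    ← (aeval_curve_eq_zero_iff H.isPrimitiveRoot H.α_ne_zero).1 hP, mul_comm (P 1), otherRoot]
  simp only [map_mul, map_sub, AlgHom.commutes, Algebra.smul_def, mul_one]

omit hP in
theorem isFibre_of_isFrame {a b : K} (ha : a ≠ 0) (hb : b ≠ 0)
    {X Y₁ Y₂ : SymbolAlgebra K 3 (algebraMap F K ρ) a b}
    (h : Φ.IsFrame ρ X Y₁ Y₂ (algebraMap K _ (P 0))) (hY₁ : Y₁ ^ 3 = algebraMap K _ (P 1))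
    (hUV : {symbolU 3 (algebraMap F K ρ) a b, symbolV 3 (algebraMap F K ρ) a b}
      ⊆ ({X, Y₁, Y₂} : Set (SymbolAlgebra K 3 (algebraMap F K ρ) a b)))
    (hK : Algebra.adjoin F (Set.range P) = ⊤) : Φ.IsFibre ρ P a b := by
  obtain ⟨f, hX, hY, hZ, hw⟩ := h.exists_algHom H.isPrimitiveRoot H.α_ne_zero
  have hS : f (Φ.yComp ρ 1 ^ 3) = algebraMap K _ (P 1) := by rw [map_pow, hY, hY₁]
  have hω := H.isPrimitiveRoot.map_of_injective (algebraMap F K).injective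
  refine ⟨isCentralSimpleOfDegree_symbol hω ha hb, f,
    surjective_of_adjoin_eq_top adjoin_symbol hK (hUV.trans ?_) ?_, hw, hS⟩
  · rintro _ (rfl | rfl | rfl)
    exacts [⟨_, hX⟩, ⟨_, hY⟩, ⟨_, hZ⟩]
  · rintro _ ⟨i, rfl⟩
    fin_cases i
    exacts [⟨_, hw⟩, ⟨_, hS⟩]

theorem isFibre_of_ne_zero (hS : P 1 ≠ 0) (hK : Algebra.adjoin F (Set.range P) = ⊤) :
    Φ.IsFibre ρ P (algebraMap F K Φ.α) (P 1) := by
  let u := symbolU 3 (algebraMap F K ρ) (algebraMap F K Φ.α) (P 1)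
  let v := symbolV 3 (algebraMap F K ρ) (algebraMap F K Φ.α) (P 1)
  have hu : u * (u * u) = Φ.α • 1 := mul_mul_self_of_cube_eq_algebraMap symbolU_pow
  have hv : v ^ 3 = algebraMap K _ (P 1) := symbolV_pow
  have hvu : v * u = ρ • (u * v) := by rw [symbolV_mul_symbolU, algebraMap_smul]
  have hunit : IsUnit v := (isUnit_pow_iff three_ne_zero).1 (hv ▸ (IsUnit.mk0 _ hS).map _)
  obtain ⟨Z, hZ⟩ := IsFrame.exists_of_isUnit_y₁ hu hunit (Algebra.commutes (P 0) u)
    (Algebra.commutes (P 0) v) (hv ▸ H.map_otherRoot_mul hP (IsScalarTower.toAlgHom F K _))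
    H.sq_add_self_add_one hvu
  refine H.isFibre_of_isFrame ((map_ne_zero _).2 H.α_ne_zero) hS hZ hv ?_ hK
  rintro _ (rfl | rfl) <;> simp [u, v]

/-- At a point with `S = 0` it is `y₂` that stays invertible, and `y₂³` takes the value
`ρ² e R - D`. -/
theorem isFibre_of_eq_zero (hS : P 1 = 0) (hK : Algebra.adjoin F (Set.range P) = ⊤) :
    Φ.IsFibre ρ P (algebraMap F K (ρ ^ 2 * Φ.e) * P 0 - algebraMap F K Φ.D)
      (algebraMap F K Φ.α) := by
  obtain ⟨a, ha⟩ : ∃ a, a = algebraMap F K (ρ ^ 2 * Φ.e) * P 0 - algebraMap F K Φ.D := ⟨_, rfl⟩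
  have ha0 : a ≠ 0 := by
    have hne := H.otherRoot_ne_zero hP hS
    rwa [otherRoot, hS, sub_zero, ← ha] at hne
  rw [← ha]
  let u := symbolU 3 (algebraMap F K ρ) a (algebraMap F K Φ.α)
  let v := symbolV 3 (algebraMap F K ρ) a (algebraMap F K Φ.α)
  let g := IsScalarTower.toAlgHom F K (SymbolAlgebra K 3 (algebraMap F K ρ) a (algebraMap F K Φ.α))
  have hv : v * (v * v) = Φ.α • 1 := mul_mul_self_of_cube_eq_algebraMap symbolV_pow
  have hua : u ^ 3 = algebraMap K _ a := symbolU_pow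
  have hu : u ^ 3 = (ρ ^ 2 * Φ.e) • g (P 0) - Φ.D • 1 := by
    refine hua.trans ((congrArg g ha).trans ?_)
    simp only [map_sub, map_mul, AlgHom.commutes, Algebra.smul_def, mul_one]
  have huv : u * v = ρ ^ 2 • (v * u) := by
    rw [symbolV_mul_symbolU, algebraMap_smul, smul_smul, ← pow_succ,
      H.isPrimitiveRoot.pow_eq_one, one_smul]
  have hunit : IsUnit u := (isUnit_pow_iff three_ne_zero).1 (hua ▸ (IsUnit.mk0 _ ha0).map _)
  have hnorm := H.map_otherRoot_mul hP g
  rw [hS, map_zero, mul_zero] at hnorm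
  obtain ⟨Z, hZ⟩ := IsFrame.exists_of_isUnit_y₂ (ρ := ρ) hv hunit (Algebra.commutes (P 0) v)
    (Algebra.commutes (P 0) u)
    (((congrArg (· * u ^ 3) (sub_eq_zero.2 hu.symm)).trans (zero_mul _)).trans hnorm)
    H.sq_add_self_add_one huv
  have hZ3 : Z ^ 3 = algebraMap K _ (P 1) := by
    have hsub := hZ.y₂_cube_eq
    rw [hu] at hsub
    rw [hS, map_zero]
    exact sub_eq_self.1 hsub.symm
  refine H.isFibre_of_isFrame ha0 ((map_ne_zero _).2 H.α_ne_zero) hZ hZ3 ?_ hK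
  rintro _ (rfl | rfl) <;> simp [u, v]

end IsAdmissible

end Fibre

section CoordinateRing

open Polynomial in
/-- The trace of `S` over `F[R]`, that is, the sum of the two roots of the equation of `E`. -/
noncomputable def tracePoly : F[X] :=
  C (ρ ^ 2 * Φ.e) * X - C Φ.D

open Polynomial in
/-- The discriminant of the equation of `E`, which is quadratic in `S`. -/
noncomputable def discPoly : F[X] :=
  Φ.tracePoly ρ ^ 2 - 4 * Φ.normPoly ρ

variable {Φ ρ}

theorem otherRoot_eq_aeval_sub {A : Type*} [CommRing A] [Algebra F A] (R S : A) :
    Φ.otherRoot ρ R S = Polynomial.aeval R (Φ.tracePoly ρ) - S := by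
  simp only [otherRoot, tracePoly, map_sub, map_mul, Polynomial.aeval_C, Polynomial.aeval_X]

theorem discPoly_ne_zero (hα : Φ.α ≠ 0) (hD : Φ.D ≠ 0) : Φ.discPoly ρ ≠ 0 := by
  intro h
  have h4 : (4 : F) = 0 := by
    have hcoeff : (Φ.discPoly ρ).coeff 3 = -(4 * Φ.α) := by
      have hdisc : Φ.discPoly ρ = Cubic.toPoly ⟨-(4 * Φ.α), (ρ ^ 2 * Φ.e) ^ 2,
          4 * (3 * Φ.α * Φ.wCoeff₁ ρ * Φ.wCoeff₂) - 2 * (ρ ^ 2 * Φ.e) * Φ.D,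
          Φ.D ^ 2 + 4 * (Φ.α ^ 2 * Φ.wCoeff₁ ρ ^ 3 + Φ.wCoeff₂ ^ 3)⟩ := by
        simp only [Cubic.toPoly, discPoly, tracePoly, normPoly, map_neg, map_add, map_sub, map_mul,
          map_pow, Polynomial.C_ofNat]
        ring
      rw [hdisc, Cubic.coeff_eq_a]
    rw [h, Polynomial.coeff_zero, eq_comm, neg_eq_zero] at hcoeff
    exact (mul_eq_zero.1 hcoeff).resolve_right hα
  have heval : (Φ.discPoly ρ).eval 0 = Φ.D ^ 2 - 4 * (Φ.normPoly ρ).eval 0 := by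
    simp [discPoly, tracePoly]
  rw [h, Polynomial.eval_zero, h4, zero_mul, sub_zero, eq_comm] at heval
  exact hD (pow_eq_zero_iff two_ne_zero |>.1 heval)

theorem eq_zero_of_forall_aeval_eq_zero {L : Type*} [Field L] [Infinite L] [Algebra F L]
    {p : Polynomial F} (h : ∀ R : L, Polynomial.aeval R p = 0) : p = 0 :=
  Polynomial.map_injective _ (algebraMap F L).injective <| Polynomial.funext fun R => by
    rw [Polynomial.eval_map_algebraMap, h, Polynomial.map_zero, Polynomial.eval_zero]

theorem exists_aeval_curve_eq_zero (hρ : IsPrimitiveRoot ρ 3) (hα : Φ.α ≠ 0) {L : Type*} [Field L]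
    [IsAlgClosed L] [Algebra F L] (R : L) : ∃ S, MvPolynomial.aeval ![R, S] (Φ.curve ρ) = 0 := by
  have hdeg : (Polynomial.X ^ 2 - Polynomial.C (Polynomial.aeval R (Φ.tracePoly ρ)) * Polynomial.X
      + Polynomial.C (Polynomial.aeval R (Φ.normPoly ρ))).degree = 2 := by compute_degree!
  obtain ⟨S, hS⟩ := IsAlgClosed.exists_root _ (hdeg ▸ two_ne_zero)
  refine ⟨S, (aeval_curve_eq_zero_iff hρ hα).2 ?_⟩
  simp only [Polynomial.IsRoot.def, Polynomial.eval_add, Polynomial.eval_sub, Polynomial.eval_pow,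
    Polynomial.eval_mul, Polynomial.eval_X, Polynomial.eval_C] at hS
  change S * Φ.otherRoot ρ R S = Polynomial.aeval R (Φ.normPoly ρ)
  rw [otherRoot_eq_aeval_sub]
  linear_combination -hS

theorem exists_eq_aeval_add_aeval_mul (hρ : IsPrimitiveRoot ρ 3) (hα : Φ.α ≠ 0)
    (κ : Φ.CoordRing ρ) : ∃ A B : Polynomial F, κ = Polynomial.aeval (Φ.coord ρ 0) A
      + Polynomial.aeval (Φ.coord ρ 0) B * Φ.coord ρ 1 := by
  have hκ : κ ∈ Algebra.adjoin F (Set.range (Φ.coord ρ)) := by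
    rw [adjoin_range_coord]
    exact Algebra.mem_top
  induction hκ using Algebra.adjoin_induction with
  | mem κ hκ =>
    obtain ⟨i, rfl⟩ := hκ
    fin_cases i
    · exact ⟨Polynomial.X, 0, by simp⟩
    · exact ⟨0, 1, by simp⟩
  | algebraMap c => exact ⟨Polynomial.C c, 0, by simp⟩
  | add κ κ' _ _ hκ hκ' =>
    obtain ⟨A, B, rfl⟩ := hκ
    obtain ⟨A', B', rfl⟩ := hκ'
    exact ⟨A + A', B + B', by simp only [map_add]; ring⟩
  | mul κ κ' _ _ hκ hκ' =>
    obtain ⟨A, B, rfl⟩ := hκ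
    obtain ⟨A', B', rfl⟩ := hκ'
    have hcurve := (aeval_curve_eq_zero_iff hρ hα).1 aeval_coord_curve
    rw [otherRoot_eq_aeval_sub] at hcurve
    refine ⟨A * A' - B * B' * Φ.normPoly ρ, A * B' + B * A' + B * B' * Φ.tracePoly ρ, ?_⟩
    simp only [map_add, map_sub, map_mul]
    linear_combination -(Polynomial.aeval (Φ.coord ρ 0) B * Polynomial.aeval (Φ.coord ρ 0) B')
      * hcurve

theorem evalPoint_aeval_add_aeval_mul {A : Type*} [CommRing A] [Algebra F A] {P : Fin 2 → A}
    (hP : MvPolynomial.aeval P (Φ.curve ρ) = 0) (p q : Polynomial F) :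
    evalPoint hP (Polynomial.aeval (Φ.coord ρ 0) p
      + Polynomial.aeval (Φ.coord ρ 0) q * Φ.coord ρ 1)
      = Polynomial.aeval (P 0) p + Polynomial.aeval (P 0) q * P 1 := by
  simp only [map_add, map_mul, ← Polynomial.aeval_algHom_apply, evalPoint_coord]

/-- If `p + q S` vanishes at both points of `E` above every `R`, then `q² disc = 0`, since `disc`
is the square of the difference of the two roots `S`. -/
theorem eq_zero_of_forall_evalPoint_eq_zero (hρ : IsPrimitiveRoot ρ 3) (hα : Φ.α ≠ 0)
    (hD : Φ.D ≠ 0) {L : Type*} [Field L] [IsAlgClosed L] [Algebra F L] {κ : Φ.CoordRing ρ}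
    (h : ∀ (P : Fin 2 → L) (hP : MvPolynomial.aeval P (Φ.curve ρ) = 0), evalPoint hP κ = 0) :
    κ = 0 := by
  have : Infinite L := IsAlgClosed.instInfinite
  obtain ⟨p, q, rfl⟩ := exists_eq_aeval_add_aeval_mul hρ hα κ
  have hvanish {R S : L} (hS : S * Φ.otherRoot ρ R S = Polynomial.aeval R (Φ.normPoly ρ)) :
      Polynomial.aeval R p + Polynomial.aeval R q * S = 0 := by
    have hP : MvPolynomial.aeval ![R, S] (Φ.curve ρ) = 0 := (aeval_curve_eq_zero_iff hρ hα).2 hS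
    exact (evalPoint_aeval_add_aeval_mul hP p q).symm.trans (h _ hP)
  have hroot (R : L) : ∃ S, S * Φ.otherRoot ρ R S = Polynomial.aeval R (Φ.normPoly ρ) := by
    obtain ⟨S, hS⟩ := exists_aeval_curve_eq_zero hρ hα R
    exact ⟨S, (aeval_curve_eq_zero_iff hρ hα).1 hS⟩
  have hq : q = 0 := by
    have hdisc : q ^ 2 * Φ.discPoly ρ = 0 := eq_zero_of_forall_aeval_eq_zero fun R : L => by
      obtain ⟨S, hS⟩ := hroot R
      have hS' : Φ.otherRoot ρ R S * Φ.otherRoot ρ R (Φ.otherRoot ρ R S)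
          = Polynomial.aeval R (Φ.normPoly ρ) := by
        rw [← hS, otherRoot_eq_aeval_sub R (Φ.otherRoot ρ R S), otherRoot_eq_aeval_sub]
        ring
      have h₁ := hvanish hS
      have h₂ := hvanish hS'
      rw [otherRoot_eq_aeval_sub] at hS h₂
      simp only [discPoly, map_mul, map_pow, map_sub, map_ofNat, ← hS]
      linear_combination (Polynomial.aeval R q * (Polynomial.aeval R (Φ.tracePoly ρ) - 2 * S))
        * (h₂ - h₁)
    exact pow_eq_zero_iff two_ne_zero |>.1
      ((mul_eq_zero.1 hdisc).resolve_right (discPoly_ne_zero hα hD))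
  have hp : p = 0 := eq_zero_of_forall_aeval_eq_zero fun R : L => by
    obtain ⟨S, hS⟩ := hroot R
    simpa only [hq, map_zero, zero_mul, add_zero] using hvanish hS
  simp only [hp, hq, map_zero, zero_mul, add_zero]

end CoordinateRing

section Points

variable {Φ ρ}

theorem adjoin_range_pointCoord (P : Φ.Point ρ) :
    Algebra.adjoin F (Set.range (Φ.pointCoord ρ P)) = ⊤ := by
  refine Subalgebra.map_injective (f := (Φ.pointField ρ P).val) Subtype.val_injective ?_
  rw [AlgHom.map_adjoin, ← Set.range_comp, Algebra.map_top, IntermediateField.range_val]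
  exact (IntermediateField.adjoin_toSubalgebra _).symm

theorem aeval_pointCoord_curve (P : Φ.Point ρ) :
    MvPolynomial.aeval (Φ.pointCoord ρ P) (Φ.curve ρ) = 0 :=
  Subtype.val_injective <|
    (MvPolynomial.comp_aeval_apply (Φ.pointCoord ρ P) (Φ.pointField ρ P).val (Φ.curve ρ)).trans P.2

theorem evalPoint_pointCoord (P : Φ.Point ρ) (κ : Φ.CoordRing ρ) :
    (evalPoint (aeval_pointCoord_curve P) κ : AlgebraicClosure F) = evalPoint P.2 κ := by
  have h : (Φ.pointField ρ P).val.comp (evalPoint (aeval_pointCoord_curve P)) = evalPoint P.2 :=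
    coordRing_algHom_ext fun i => by
      rw [AlgHom.comp_apply, evalPoint_coord, evalPoint_coord]
      rfl
  exact DFunLike.congr_fun h κ

theorem evalPoint_smul (σ : Gal(AlgebraicClosure F/F)) (P : Φ.Point ρ) (κ : Φ.CoordRing ρ) :
    evalPoint (σ • P).2 κ = σ (evalPoint P.2 κ) := by
  have h : evalPoint (σ • P).2 = (σ : AlgebraicClosure F →ₐ[F] _).comp (evalPoint P.2) :=
    coordRing_algHom_ext fun i => by
      rw [AlgHom.comp_apply, evalPoint_coord, evalPoint_coord]
      rfl
  exact DFunLike.congr_fun h κ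

end Points

namespace IsAdmissible

variable {Φ ρ} (H : Φ.IsAdmissible ρ)

/-- The two-sided ideal `I` contracts, under `F[E] → C_Φ`, to the maximal ideal of the point `P`. -/
def LiesOver (I : TwoSidedIdeal Φ.Alg) (P : Φ.Point ρ) : Prop :=
  ∀ κ, (H.toCenter κ : Φ.Alg) ∈ I ↔ evalPoint P.2 κ = 0

include H

theorem map_toCenter {K B : Type*} [CommRing K] [Algebra F K] [Ring B] [Algebra F B] [Algebra K B]
    [IsScalarTower F K B] {P : Fin 2 → K} (hP : MvPolynomial.aeval P (Φ.curve ρ) = 0)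
    {f : Φ.Alg →ₐ[F] B} (hw : f (Φ.w ρ) = algebraMap K B (P 0))
    (hS : f (Φ.yComp ρ 1 ^ 3) = algebraMap K B (P 1)) (κ : Φ.CoordRing ρ) :
    f (H.toCenter κ) = algebraMap K B (evalPoint hP κ) := by
  have h : (f.comp (Subalgebra.center F Φ.Alg).val).comp H.toCenter
      = (IsScalarTower.toAlgHom F K B).comp (evalPoint hP) := by
    refine coordRing_algHom_ext fun i => ?_
    rw [AlgHom.comp_apply, AlgHom.comp_apply, H.toCenter_coord, AlgHom.comp_apply, evalPoint_coord]
    fin_cases i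
    exacts [hw, hS]
  exact DFunLike.congr_fun h κ

theorem isFibre_pointCoord_of_ne_zero {P : Φ.Point ρ} (hS : P.1 1 ≠ 0) :
    Φ.IsFibre ρ (Φ.pointCoord ρ P) (algebraMap F _ Φ.α) (Φ.pointCoord ρ P 1) :=
  H.isFibre_of_ne_zero (aeval_pointCoord_curve P) (fun h => hS (congrArg Subtype.val h))
    (adjoin_range_pointCoord P)

theorem isFibre_pointCoord_of_eq_zero {P : Φ.Point ρ} (hS : P.1 1 = 0) :
    Φ.IsFibre ρ (Φ.pointCoord ρ P)
      (algebraMap F _ (ρ ^ 2 * Φ.e) * Φ.pointCoord ρ P 0 - algebraMap F _ Φ.D)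
      (algebraMap F _ Φ.α) :=
  H.isFibre_of_eq_zero (aeval_pointCoord_curve P) (Subtype.ext hS) (adjoin_range_pointCoord P)

theorem exists_isFibre_pointCoord (P : Φ.Point ρ) :
    ∃ a b, Φ.IsFibre ρ (Φ.pointCoord ρ P) a b := by
  by_cases hS : P.1 1 = 0
  · exact ⟨_, _, H.isFibre_pointCoord_of_eq_zero hS⟩
  · exact ⟨_, _, H.isFibre_pointCoord_of_ne_zero hS⟩

theorem liesOver_ker {P : Φ.Point ρ} {B : Type*} [Ring B] [Nontrivial B] [Algebra F B]
    [Algebra (Φ.pointField ρ P) B] [IsScalarTower F (Φ.pointField ρ P) B] {f : Φ.Alg →ₐ[F] B}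
    (hw : f (Φ.w ρ) = algebraMap _ B (Φ.pointCoord ρ P 0))
    (hS : f (Φ.yComp ρ 1 ^ 3) = algebraMap _ B (Φ.pointCoord ρ P 1)) :
    H.LiesOver (TwoSidedIdeal.ker f) P := fun κ => by
  rw [TwoSidedIdeal.mem_ker, H.map_toCenter (aeval_pointCoord_curve P) hw hS,
    FaithfulSMul.algebraMap_eq_zero_iff, ← evalPoint_pointCoord, ZeroMemClass.coe_eq_zero]

theorem exists_liesOver (P : Φ.Point ρ) : ∃ I : SimpleImage Φ.Alg, H.LiesOver I.1 P := by
  obtain ⟨a, b, hsymbol, f, hf, hw, hS⟩ := H.exists_isFibre_pointCoord P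
  have := hsymbol.2.1
  exact ⟨⟨TwoSidedIdeal.ker f, hsymbol.2.1.of_ringEquiv
    (quotientKerAlgEquiv f hf).symm.toRingEquiv⟩, H.liesOver_ker hw hS⟩

theorem toCenter_injective : Function.Injective H.toCenter := by
  refine (injective_iff_map_eq_zero _).2 fun κ hκ =>
    eq_zero_of_forall_evalPoint_eq_zero (L := AlgebraicClosure F) H.isPrimitiveRoot H.α_ne_zero
      H.D_ne_zero fun P hP => ?_
  obtain ⟨I, hI⟩ := H.exists_liesOver ⟨P, hP⟩
  refine (hI κ).1 ?_
  rw [hκ]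
  exact zero_mem I.1

theorem center_eq_adjoin :
    Subalgebra.center F Φ.Alg = Algebra.adjoin F {Φ.yComp ρ 1 ^ 3, Φ.w ρ} := by
  let f := (Subalgebra.center F Φ.Alg).val.comp H.toCenter
  have hcoord : f ∘ Φ.coord ρ = ![Φ.w ρ, Φ.yComp ρ 1 ^ 3] := by
    ext i
    fin_cases i
    exacts [congrArg Subtype.val (H.toCenter_coord 0), congrArg Subtype.val (H.toCenter_coord 1)]
  calc Subalgebra.center F Φ.Alg = f.range := by
        rw [AlgHom.range_comp, (AlgHom.range_eq_top _).2 H.toCenter_surjective, Algebra.map_top,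
          Subalgebra.range_val]
    _ = (Algebra.adjoin F (Set.range (Φ.coord ρ))).map f := by
        rw [adjoin_range_coord, Algebra.map_top]
    _ = Algebra.adjoin F {Φ.yComp ρ 1 ^ 3, Φ.w ρ} := by
        rw [AlgHom.map_adjoin, ← Set.range_comp, hcoord, Matrix.range_cons_cons_empty,
          Set.pair_comm]

theorem exists_coordRing_equiv_center : ∃ φ : Φ.CoordRing ρ ≃ₐ[F] Subalgebra.center F Φ.Alg,
    (φ (Φ.coord ρ 0) : Φ.Alg) = Φ.w ρ ∧ (φ (Φ.coord ρ 1) : Φ.Alg) = Φ.yComp ρ 1 ^ 3 :=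
  ⟨AlgEquiv.ofBijective H.toCenter ⟨H.toCenter_injective, H.toCenter_surjective⟩,
    congrArg Subtype.val (H.toCenter_coord 0), congrArg Subtype.val (H.toCenter_coord 1)⟩

theorem isAzumaya_and_rankAtStalk : IsAzumaya (Subring.center Φ.Alg) Φ.Alg ∧
    ∀ p : PrimeSpectrum (Subring.center Φ.Alg), Module.rankAtStalk Φ.Alg p = 9 := by
  let := H.algebraCoordRing
  have : FaithfulSMul (Subring.center Φ.Alg) Φ.Alg :=
    (faithfulSMul_iff_algebraMap_injective _ _).2 Subtype.val_injective
  have hcover := H.isSymbolCover.map (S := Subring.center Φ.Alg)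
    (((Subalgebra.center F Φ.Alg).val.comp H.toCenter).toRingHom.codRestrict (Subring.center Φ.Alg)
      fun κ => (H.toCenter κ).2) fun _ => rfl
  exact ⟨hcover.isAzumaya, fun p => hcover.rankAtStalk_eq p⟩

end IsAdmissible

section SimpleImages

namespace IsAdmissible

variable {Φ ρ} (H : Φ.IsAdmissible ρ) {P Q : Φ.Point ρ} {I J : TwoSidedIdeal Φ.Alg}

include H

theorem le_of_forall_toCenter_mem
    (hIJ : ∀ κ, (H.toCenter κ : Φ.Alg) ∈ I → (H.toCenter κ : Φ.Alg) ∈ J) : I ≤ J := by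
  let := H.algebraCoordRing
  exact H.isSymbolCover.ideal_le hIJ

theorem eq_of_liesOver (hI : H.LiesOver I P) (hJ : H.LiesOver J P) : I = J :=
  le_antisymm (H.le_of_forall_toCenter_mem fun κ => (hJ κ).2 ∘ (hI κ).1)
    (H.le_of_forall_toCenter_mem fun κ => (hI κ).2 ∘ (hJ κ).1)

theorem imageIsSymbol {I : SimpleImage Φ.Alg} (hI : H.LiesOver I.1 P) {a b : Φ.pointField ρ P}
    (hab : Φ.IsFibre ρ (Φ.pointCoord ρ P) a b) : Φ.ImageIsSymbol ρ P I a b := by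
  obtain ⟨hsymbol, f, hf, hw, hS⟩ := hab
  have := hsymbol.2.1
  obtain ⟨I, hI'⟩ := I
  obtain rfl : TwoSidedIdeal.ker f = I := H.eq_of_liesOver (H.liesOver_ker hw hS) hI
  exact ⟨hsymbol, quotientKerAlgEquiv f hf, hw, hS⟩

theorem liesOver_smul (hI : H.LiesOver I P) (σ : Gal(AlgebraicClosure F/F)) :
    H.LiesOver I (σ • P) := fun κ => by
  rw [hI, evalPoint_smul, map_eq_zero_iff σ σ.injective]

theorem exists_smul_eq (hP : H.LiesOver I P) (hQ : H.LiesOver I Q) :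
    ∃ σ : Gal(AlgebraicClosure F/F), σ • Q = P := by
  obtain ⟨σ, hσ⟩ := exists_algHom_comp_eq (evalPoint Q.2) (evalPoint P.2)
    fun κ => (hP κ).1 ∘ (hQ κ).2
  refine ⟨AlgEquiv.ofBijective σ (Algebra.IsAlgebraic.algHom_bijective σ),
    Subtype.ext (funext fun i => ?_)⟩
  rw [← evalPoint_coord P.2, ← hσ, AlgHom.comp_apply, evalPoint_coord]
  rfl

theorem exists_point_liesOver (I : SimpleImage Φ.Alg) : ∃ P : Φ.Point ρ, H.LiesOver I.1 P := by
  have hI : Nontrivial I.1.ringCon.Quotient := I.2.instNontrivial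
  let g : Φ.CoordRing ρ →+* I.1.ringCon.Quotient :=
    I.1.ringCon.mk'.comp ((Subalgebra.center F Φ.Alg).val.comp H.toCenter).toRingHom
  obtain ⟨φ, hφ⟩ := exists_algHom_forall_mem_eq_zero (F := F) (AlgebraicClosure F)
    (RingHom.ker_ne_top g)
  let P : Φ.Point ρ := ⟨fun i => φ (Φ.coord ρ i), by
    rw [← MvPolynomial.comp_aeval_apply, aeval_coord_curve, map_zero]⟩
  have hP : evalPoint P.2 = φ := coordRing_algHom_ext fun i => evalPoint_coord P.2 i
  obtain ⟨J, hJ⟩ := H.exists_liesOver P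
  have hle : I.1 ≤ J.1 := H.le_of_forall_toCenter_mem fun κ hκ => by
    rw [hJ, hP]
    exact hφ κ ((RingCon.eq _).2 ((TwoSidedIdeal.mem_iff _ _).1 hκ))
  exact ⟨P, eq_of_le_of_isSimpleRing_quotient I.2 J.2.instNontrivial hle ▸ hJ⟩

theorem exists_equiv_simpleImage :
    ∃ Ψ : MulAction.orbitRel.Quotient Gal(AlgebraicClosure F/F) (Φ.Point ρ) ≃ SimpleImage Φ.Alg,
      ∀ P : Φ.Point ρ, H.LiesOver (Ψ (Quotient.mk'' P)).1 P := by
  choose I hI using H.exists_liesOver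
  have hIeq (P Q) : I P = I Q ↔ MulAction.orbitRel Gal(AlgebraicClosure F/F) (Φ.Point ρ) P Q := by
    refine ⟨fun h => H.exists_smul_eq (hI P) (h ▸ hI Q), ?_⟩
    rintro ⟨σ, rfl⟩
    exact Subtype.ext (H.eq_of_liesOver (hI _) (H.liesOver_smul (hI Q) σ))
  refine ⟨Equiv.ofBijective (Quotient.lift I fun P Q => (hIeq P Q).2) ⟨?_, fun J => ?_⟩, hI⟩
  · rintro ⟨P⟩ ⟨Q⟩ h
    exact Quotient.sound ((hIeq P Q).1 h)
  · obtain ⟨P, hP⟩ := H.exists_point_liesOver J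
    exact ⟨Quotient.mk'' P, Subtype.ext (H.eq_of_liesOver (hI P) hP)⟩

end IsAdmissible

end SimpleImages

end Coeffs

end CubicClifford

theorem mainTheorem5_general {F : Type*} [Field F] {ρ : F} (hρ : IsPrimitiveRoot ρ 3)
    {Φ : CubicClifford.Coeffs F} (hD : Φ.D ≠ 0)
    (hα : IsField (AdjoinRoot (Polynomial.X ^ 3 - Polynomial.C Φ.α))) :
    (IsAzumaya (Subring.center Φ.Alg) Φ.Alg ∧
      ∀ p : PrimeSpectrum (Subring.center Φ.Alg), Module.rankAtStalk Φ.Alg p = 9) ∧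
    (Subalgebra.center F Φ.Alg = Algebra.adjoin F {Φ.yComp ρ 1 ^ 3, Φ.w ρ} ∧
      ∃ φ : Φ.CoordRing ρ ≃ₐ[F] Subalgebra.center F Φ.Alg,
        (φ (Φ.coord ρ 0) : Φ.Alg) = Φ.w ρ ∧ (φ (Φ.coord ρ 1) : Φ.Alg) = Φ.yComp ρ 1 ^ 3) ∧
    ∃ Ψ : MulAction.orbitRel.Quotient Gal(AlgebraicClosure F/F) (Φ.Point ρ) ≃
        CubicClifford.SimpleImage Φ.Alg,
      ∀ P : Φ.Point ρ,
        (P.1 1 ≠ 0 → Φ.ImageIsSymbol ρ P (Ψ (Quotient.mk'' P))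
          (algebraMap F _ Φ.α) (Φ.pointCoord ρ P 1)) ∧
        (P.1 1 = 0 → Φ.ImageIsSymbol ρ P (Ψ (Quotient.mk'' P))
          (algebraMap F _ (ρ ^ 2 * Φ.e) * Φ.pointCoord ρ P 0 - algebraMap F _ Φ.D)
          (algebraMap F _ Φ.α)) := by
  have H : Φ.IsAdmissible ρ := ⟨hρ, hα, hD⟩
  obtain ⟨Ψ, hΨ⟩ := H.exists_equiv_simpleImage
  exact ⟨H.isAzumaya_and_rankAtStalk, ⟨H.center_eq_adjoin, H.exists_coordRing_equiv_center⟩, Ψ,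
    fun P => ⟨fun hS => H.imageIsSymbol (hΨ P) (H.isFibre_pointCoord_of_ne_zero hS),
      fun hS => H.imageIsSymbol (hΨ P) (H.isFibre_pointCoord_of_eq_zero hS)⟩⟩

theorem mainTheorem5 {F : Type*} [Field F] (h2 : ringChar F ≠ 2) (h3 : ringChar F ≠ 3)
    (ρ : F) (hρ : IsPrimitiveRoot ρ 3) (Φ : CubicClifford.Coeffs F)
    (hΔ : (Φ.weierstrass ρ).Δ ≠ 0) (hD : Φ.D ≠ 0)
    (hα : IsField (AdjoinRoot (Polynomial.X ^ 3 - Polynomial.C Φ.α))) :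
    (IsAzumaya (Subring.center Φ.Alg) Φ.Alg ∧
      ∀ p : PrimeSpectrum (Subring.center Φ.Alg), Module.rankAtStalk Φ.Alg p = 9) ∧
    (Subalgebra.center F Φ.Alg = Algebra.adjoin F {Φ.yComp ρ 1 ^ 3, Φ.w ρ} ∧
      ∃ φ : Φ.CoordRing ρ ≃ₐ[F] Subalgebra.center F Φ.Alg,
        (φ (Φ.coord ρ 0) : Φ.Alg) = Φ.w ρ ∧ (φ (Φ.coord ρ 1) : Φ.Alg) = Φ.yComp ρ 1 ^ 3) ∧
    ∃ Ψ : MulAction.orbitRel.Quotient Gal(AlgebraicClosure F/F) (Φ.Point ρ) ≃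
        CubicClifford.SimpleImage Φ.Alg,
      ∀ P : Φ.Point ρ,
        (P.1 1 ≠ 0 → Φ.ImageIsSymbol ρ P (Ψ (Quotient.mk'' P))
          (algebraMap F _ Φ.α) (Φ.pointCoord ρ P 1)) ∧
        (P.1 1 = 0 → Φ.ImageIsSymbol ρ P (Ψ (Quotient.mk'' P))
          (algebraMap F _ (ρ ^ 2 * Φ.e) * Φ.pointCoord ρ P 0 - algebraMap F _ Φ.D)
          (algebraMap F _ Φ.α)) :=
  mainTheorem5_general hρ hD hα
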